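/- **Setting.** Let $W$ be a conformal vertex algebra, that is, a vertex algebra on a complex vector superspace, with products $a_{n}b$ ($Y(a,z)=\sum_{n\in\mathbb Z}a_{n}z^{-n-1}$), vacuum $\mathbf 1\neq 0$, translation operator $T$ and an even vector $L$, such that, writing $v(n)=v_{n+1}$, the operators $L(n)$ satisfy the Virasoro relations $[L(m),L(n)]=(m-n)L(m+n)+\frac{m^3-m}{12}\delta_{m+n,0}\,c$ with $c\in\mathbb C$ (the central charge of $W$), $L(-1)=T$, and $W=\bigoplus_{n\in\frac12\mathbb Z_{\ge0}}W(n)$ is the decomposition of $W$ into eigenspaces of $L(0)$, where $\dim W(n)<\infty$ for all $n$ and $W(0)=\mathbb C\mathbf 1$. Assume: 1. there is a conjugate-linear (parity preserving) involution $\phi$ of the vertex algebra $W$ with $\phi(L)=L$; 2. $W(\frac12)=\{0\}$; 3. every $a\in\mathfrak a:=W(1)$ is $L$-primary, i.e. $L(n)a=0$ for $n>0$. Then $\mathfrak a$ is a Lie superalgebra for $[a,b]=a_{0}b$, with invariant supersymmetric form $\langle\cdot,\cdot\rangle$ given by $a_{1}b=\langle a,b\rangle\mathbf 1$. Assume moreover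 that $\mathfrak a=\bigoplus_{i=0}^r\mathfrak a_i$ is a direct sum of ideals, with $\mathfrak a_0$ an even abelian Lie algebra (possibly zero) and each $\mathfrak a_i$, $i\ge1$, a simple Lie algebra or a basic Lie superalgebra (a simple finite-dimensional Lie superalgebra with reductive even part and a nonzero even invariant supersymmetric bilinear form). For $i\ge 1$ fix a non-degenerate even invariant supersymmetric form $\langle\cdot,\cdot\rangle_i$ on $\mathfrak a_i$, in any normalization for which $\langle\cdot,\cdot\rangle|_{\mathfrak a_i\times\mathfrak a_i}=k_i\langle\cdot,\cdot\rangle_i$ with $k_i\in\mathbb R$; let $\{x_{i,j}\}_j$ and $\{x_i^{j}\}_j$ be dual bases of $\mathfrak a_i$, $\langle x_{i,j},x_i^{l}\rangle_i=\delta_{jl}$, and let $2h_i^\vee$ be the eigenvalue of the Casimir element $\sum_j x_i^{j}x_{i,j}$ on $\mathfrak a_i$. Assume $k_i\ne-h_i^\vee$ for all $i\ge1$. Choose a basis $a_1,\dots,a_{s+t}$ of $\mathfrak a_0$ that is orthogonal for $\langle\cdot,\cdot\rangle$, with $\langle a_l,a_l\rangle=0$ for $l\le s$ and $\langle a_l,a_l\rangle=1$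 for $l>s$. With $:\!ab\!:\,=a_{-1}b$, put $$L^{\mathfrak a}=\tfrac12\sum_{l=s+1}^{s+t}:\!a_la_l\!:+\sum_{i=1}^r\frac1{2(k_i+h_i^\vee)}\sum_j:\!x_i^{j}x_{i,j}\!:\ \in W(2),$$ and let $c_{\mathfrak a}\in\mathbb C$ be defined by $L^{\mathfrak a}(2)L^{\mathfrak a}=\frac12c_{\mathfrak a}\mathbf 1$. Let $V(\mathfrak a)$ be the vertex subalgebra of $W$ generated by $\mathfrak a$. A subset $\mathfrak V\subset W$ *strongly generates* $W$ if $W$ is spanned by the normally ordered products $:\!T^{j_1}(w_1)\cdots T^{j_p}(w_p)\!:$ (nested from the right) with $p\ge0$, $j_1,\dots,j_p\ge0$ and $w_1,\dots,w_p\in\mathfrak V$. **Theorem.** Let $S\subset W$ be a set of vectors that are homogeneous for the grading $W=\bigoplus_n W(n)$, such that $W$ is strongly generated by $\mathfrak a\cup\{L-L^{\mathfrak a}\}\cup S$ and $(L-L^{\mathfrak a})(2)X=0$ for every $X\in S\cap W(2)$. Then $L-L^{\mathfrak a}$ generates a proper ideal of $W$ if and only if $c=c_{\mathfrak a}$. Likewise,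 there is a proper ideal $J$ of $W$ such that the image of $V(\mathfrak a)$ in $W/J\neq0$, with the image of $L^{\mathfrak a}$ as its distinguished vector, is conformally embedded (i.e. $L^{\mathfrak a}$ and $L$ have the same image in $W/J$) if and only if $c=c_{\mathfrak a}$. -/

import Mathlib

open scoped VertexOperator

/-- The sign `(-1)^{pq}` attached to two parities. -/
def koszulSign (p q : ZMod 2) : ℂ := (-1) ^ (p.val * q.val)

/-- A vertex algebra structure on a complex vector superspace `W = W_0 ⊕ W_1`: a vacuum vector and
a state-field correspondence `Y(a,z) = ∑ a_(n) z^{-n-1}`, where `a_(n) = (Y a)[[n]]`.  That each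
`Y(a,z)b` is a Laurent series with finitely many negative powers is part of `VertexOperator`. -/
structure VertexSuperalgebra (W : Type*) [AddCommGroup W] [Module ℂ W] where
  /-- `parity 0` is the even part, `parity 1` the odd part. -/
  parity : ZMod 2 → Submodule ℂ W
  isCompl_parity : IsCompl (parity 0) (parity 1)
  vac : W
  Y : W →ₗ[ℂ] VertexOperator ℂ W
  vac_even : vac ∈ parity 0
  mode_parity : ∀ (p q : ZMod 2) (a b : W) (n : ℤ), a ∈ parity p → b ∈ parity q →
    ((Y a)[[n]]) b ∈ parity (p + q)
  vac_mode : ∀ (n : ℤ) (b : W), ((Y vac)[[n]]) b = if n = -1 then b else 0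
  mode_vac_neg_one : ∀ a : W, ((Y a)[[-1]]) vac = a
  mode_vac_nonneg : ∀ (a : W) (n : ℤ), 0 ≤ n → ((Y a)[[n]]) vac = 0
  /-- The Borcherds (Jacobi) identity; all three sums have finitely many non-zero terms. -/
  borcherds : ∀ (p q : ZMod 2) (a b c : W) (m n k : ℤ), a ∈ parity p → b ∈ parity q →
    ∑ᶠ j : ℕ, ((Ring.choose m j : ℤ) : ℂ) • ((Y (((Y a)[[n + j]]) b))[[m + k - j]]) c =
    ∑ᶠ j : ℕ, ((-1 : ℂ) ^ j * ((Ring.choose n j : ℤ) : ℂ)) •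
      (((Y a)[[m + n - j]]) (((Y b)[[k + j]]) c)
        - (koszulSign p q * (-1 : ℂ) ^ n) • ((Y b)[[n + k - j]]) (((Y a)[[m + j]]) c))

namespace VertexSuperalgebra

variable {W : Type*} [AddCommGroup W] [Module ℂ W] (V : VertexSuperalgebra W)

/-- The endomorphism `a_(n)` of `W`, the coefficient of `z^{-n-1}` in `Y(a,z)`. -/
noncomputable def mode (a : W) (n : ℤ) : Module.End ℂ W := (V.Y a)[[n]]

/-- The translation operator `T a = a_(-2) 1`. -/
noncomputable def T (a : W) : W := V.mode a (-2) V.vac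

/-- A subspace that is the sum of its even and its odd part. -/
def IsGraded (U : Submodule ℂ W) : Prop := U ≤ (U ⊓ V.parity 0) ⊔ (U ⊓ V.parity 1)

/-- Two-sided, translation-invariant, `ℤ/2`-graded ideals. -/
structure IsIdeal (J : Submodule ℂ W) : Prop where
  graded : V.IsGraded J
  translation : ∀ x ∈ J, V.T x ∈ J
  left : ∀ (a : W) (n : ℤ), ∀ x ∈ J, V.mode a n x ∈ J
  right : ∀ (a : W) (n : ℤ), ∀ x ∈ J, V.mode x n a ∈ J

/-- The ideal generated by a vector. -/
def idealGeneratedBy (v : W) : Submodule ℂ W := sInf {J | V.IsIdeal J ∧ v ∈ J}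

/-- The vertex subalgebra generated by a subset. -/
def subalgebraGeneratedBy (X : Set W) : Submodule ℂ W :=
  sInf {U | X ⊆ U ∧ V.vac ∈ U ∧ ∀ (n : ℤ), ∀ a ∈ U, ∀ b ∈ U, V.mode a n b ∈ U}

/-- The normally ordered product `:T^{j₁}(w₁) T^{j₂}(w₂) ⋯ T^{jᵣ}(wᵣ):`, nested from the right
(`:a b: = a_(-1) b`); the empty product is the vacuum. -/
noncomputable def normalOrderedProduct : List (ℕ × W) → W
  | [] => V.vac
  | (j, w) :: l => V.mode (V.T^[j] w) (-1) (normalOrderedProduct l)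

/-- `W` is spanned by the normally ordered products of derivatives of elements of `X`. -/
def StronglyGenerates (X : Set W) : Prop :=
  Submodule.span ℂ {u | ∃ l : List (ℕ × W), (∀ t ∈ l, t.2 ∈ X) ∧ u = V.normalOrderedProduct l} = ⊤

/-- A conjugate-linear involution of a vertex algebra: a conjugate-linear, parity preserving
automorphism of order at most two. -/
structure IsConjugateInvolution (φ : W →ₛₗ[starRingEnd ℂ] W) : Prop where
  involutive : ∀ a, φ (φ a) = a
  parity : ∀ p, ∀ a ∈ V.parity p, φ a ∈ V.parity p
  map_vac : φ V.vac = V.vac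
  map_mode : ∀ (a b : W) (n : ℤ), φ (V.mode a n b) = V.mode (φ a) n (φ b)

/-! ### Lie superalgebras inside a vertex algebra, for the bracket `[a,b] = a_(0) b` -/

/-- `𝔤`, with the bracket `[a,b] = a_(0) b`, is a simple superalgebra: it is graded, closed under
the bracket and not abelian, and has no graded ideals but `0` and `𝔤`. -/
structure IsSimpleLie (𝔤 : Submodule ℂ W) : Prop where
  graded : V.IsGraded 𝔤
  closed : ∀ a ∈ 𝔤, ∀ b ∈ 𝔤, V.mode a 0 b ∈ 𝔤
  nonabelian : ∃ a ∈ 𝔤, ∃ b ∈ 𝔤, V.mode a 0 b ≠ 0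
  eq_bot_or_eq : ∀ I ≤ 𝔤, V.IsGraded I → (∀ a ∈ 𝔤, ∀ b ∈ I, V.mode a 0 b ∈ I) → I = ⊥ ∨ I = 𝔤

/-- The even part `𝔤_0` of `𝔤` is a reductive Lie algebra: its adjoint representation is
completely reducible. -/
def HasReductiveEvenPart (𝔤 : Submodule ℂ W) : Prop :=
  ∀ I ≤ 𝔤 ⊓ V.parity 0, (∀ a ∈ 𝔤 ⊓ V.parity 0, ∀ b ∈ I, V.mode a 0 b ∈ I) →
    ∃ I' ≤ 𝔤 ⊓ V.parity 0, (∀ a ∈ 𝔤 ⊓ V.parity 0, ∀ b ∈ I', V.mode a 0 b ∈ I') ∧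
      Disjoint I I' ∧ I ⊔ I' = 𝔤 ⊓ V.parity 0

/-- A non-degenerate, even, supersymmetric, invariant bilinear form on `𝔤`. -/
structure IsInvariantForm (𝔤 : Submodule ℂ W) (B : LinearMap.BilinForm ℂ 𝔤) : Prop where
  nondegenerate : B.Nondegenerate
  even : ∀ (p q : ZMod 2) (a b : 𝔤), (a : W) ∈ V.parity p → (b : W) ∈ V.parity q → p ≠ q →
    B a b = 0
  supersymmetric : ∀ (p q : ZMod 2) (a b : 𝔤), (a : W) ∈ V.parity p → (b : W) ∈ V.parity q →
    B a b = koszulSign p q * B b a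
  /-- `⟨[a,b],c⟩ = ⟨a,[b,c]⟩`; here `ab = [a,b]` and `bc = [b,c]`. -/
  invariant : ∀ a b c ab bc : 𝔤, (ab : W) = V.mode a 0 (b : W) → (bc : W) = V.mode b 0 (c : W) →
    B ab c = B a bc

end VertexSuperalgebra

/-- A conformal vertex algebra, with conformal (Virasoro) vector `L` and central charge `c`.
The modes of `L` are `L(n) = L_(n+1)`. -/
structure ConformalVertexAlgebra (W : Type*) [AddCommGroup W] [Module ℂ W] extends
    VertexSuperalgebra W where
  L : W
  c : ℂ
  L_even : L ∈ parity 0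
  virasoro : ∀ (m n : ℤ) (w : W),
    toVertexSuperalgebra.mode L (m + 1) (toVertexSuperalgebra.mode L (n + 1) w)
      - toVertexSuperalgebra.mode L (n + 1) (toVertexSuperalgebra.mode L (m + 1) w) =
    ((m : ℂ) - n) • toVertexSuperalgebra.mode L (m + n + 1) w
      + (if m + n = 0 then ((m : ℂ) ^ 3 - m) / 12 * c else 0) • w
  /-- `L(-1) = T`. -/
  L_neg_one : ∀ w : W, toVertexSuperalgebra.mode L 0 w = toVertexSuperalgebra.T w
  /-- `W` is the (automatically direct) sum of the eigenspaces `W(Δ)`, `Δ ∈ ½ℤ₊`, of `L(0)`. -/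
  iSup_eigenspace :
    ⨆ n : ℕ, (toVertexSuperalgebra.mode L 1).eigenspace ((n : ℂ) / 2) = ⊤
  finiteDimensional_eigenspace : ∀ n : ℕ,
    FiniteDimensional ℂ ((toVertexSuperalgebra.mode L 1).eigenspace ((n : ℂ) / 2))
  vac_ne_zero : vac ≠ 0
  eigenspace_zero : (toVertexSuperalgebra.mode L 1).eigenspace 0 = Submodule.span ℂ {vac}

namespace ConformalVertexAlgebra

open VertexSuperalgebra

variable {W : Type*} [AddCommGroup W] [Module ℂ W] (V : ConformalVertexAlgebra W)

/-- `W(Δ)`, the space of vectors of conformal weight `Δ`. -/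
noncomputable def weightSpace (Δ : ℂ) : Submodule ℂ W := (V.mode V.L 1).eigenspace Δ

/-- `a` is an eigenvector of `L(0)` annihilated by all `L(n)`, `n > 0`. -/
def IsPrimary (a : W) : Prop :=
  (∃ Δ : ℂ, a ∈ V.weightSpace Δ) ∧ ∀ n : ℤ, 0 < n → V.mode V.L (n + 1) a = 0

/-- A decomposition `𝔞 = 𝔞_0 ⊕ 𝔞_1 ⊕ ⋯ ⊕ 𝔞_r` of the Lie superalgebra `𝔞 = W(1)`
(`[a,b] = a_(0) b`) into ideals, where `𝔞_0` is an even abelian Lie algebra and `𝔞_1, …, 𝔞_r` are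
basic Lie superalgebras (simple, with reductive even part and with a non-degenerate even invariant
supersymmetric form; simple Lie algebras are among them), all levels being non-critical, together
with the choices (normalized forms, bases) used in the Sugawara construction.
The form `⟨·,·⟩` of `𝔞` is given by `a_(1) b = ⟨a,b⟩ 1`. -/
structure SugawaraDatum where
  r : ℕ
  /-- `𝔞 0` is the abelian summand and `𝔞 i.succ`, `i : Fin r`, are the basic ones. -/
  𝔞 : Fin (r + 1) → Submodule ℂ W
  indep : iSupIndep 𝔞
  iSup_eq : ⨆ i, 𝔞 i = V.weightSpace 1
  graded : ∀ i, V.IsGraded (𝔞 i)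
  ideal : ∀ i, ∀ a ∈ V.weightSpace 1, ∀ b ∈ 𝔞 i, V.mode a 0 b ∈ 𝔞 i
  zero_even : 𝔞 0 ≤ V.parity 0
  zero_abelian : ∀ a ∈ 𝔞 0, ∀ b ∈ 𝔞 0, V.mode a 0 b = 0
  simple : ∀ i : Fin r, V.IsSimpleLie (𝔞 i.succ)
  reductive : ∀ i : Fin r, V.HasReductiveEvenPart (𝔞 i.succ)
  /-- The (normalized) form `⟨·,·⟩_i` on `𝔞_i`, `i ≥ 1`. -/
  form : ∀ i : Fin r, LinearMap.BilinForm ℂ (𝔞 i.succ)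
  form_invariant : ∀ i : Fin r, V.IsInvariantForm (𝔞 i.succ) (form i)
  /-- The level `k_i`: on `𝔞_i` one has `⟨·,·⟩ = k_i ⟨·,·⟩_i`. -/
  k : Fin r → ℝ
  form_eq : ∀ (i : Fin r) (a b : 𝔞 i.succ),
    V.mode (a : W) 1 (b : W) = ((k i : ℂ) * form i a b) • V.vac
  /-- The dimension of `𝔞_i`, `i ≥ 1`. -/
  d : Fin r → ℕ
  /-- A basis `{x_j}` of `𝔞_i`, `i ≥ 1`. -/
  x : ∀ i : Fin r, Module.Basis (Fin (d i)) ℂ (𝔞 i.succ)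
  /-- The dual basis `{x^j}`. -/
  y : ∀ i : Fin r, Fin (d i) → 𝔞 i.succ
  dual : ∀ (i : Fin r) (j l : Fin (d i)), form i (x i j) (y i l) = if j = l then 1 else 0
  /-- The number `h_i^∨`: the Casimir element `∑ x^j x_j` acts on `𝔞_i` as `2 h_i^∨`. -/
  h : Fin r → ℂ
  casimir : ∀ (i : Fin r) (z : 𝔞 i.succ),
    ∑ j, V.mode (y i j : W) 0 (V.mode (x i j : W) 0 (z : W)) = (2 * h i) • (z : W)
  noncritical : ∀ i : Fin r, (k i : ℂ) ≠ - h i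
  /-- The numbers of isotropic and of non-isotropic vectors in the basis of `𝔞_0`. -/
  s : ℕ
  t : ℕ
  /-- A basis of `𝔞_0` orthogonal for `⟨·,·⟩`, whose first `s` vectors span the kernel of the form
  on `𝔞_0` and whose other `t` vectors have norm `1`. -/
  e : Module.Basis (Fin s ⊕ Fin t) ℂ (𝔞 0)
  e_isotropic : ∀ i : Fin s, V.mode (e (Sum.inl i) : W) 1 (e (Sum.inl i) : W) = 0
  e_normalized : ∀ i : Fin t, V.mode (e (Sum.inr i) : W) 1 (e (Sum.inr i) : W) = V.vac
  e_orthogonal : ∀ i j, i ≠ j → V.mode (e i : W) 1 (e j : W) = 0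

/-- The Sugawara vector `L^𝔞 = ½ ∑ :a_i a_i: + ∑_{i ≥ 1} (2(k_i + h_i^∨))⁻¹ ∑_j :x^j x_j:`. -/
noncomputable def SugawaraDatum.sugawara {V : ConformalVertexAlgebra W} (D : V.SugawaraDatum) : W :=
  (1 / 2 : ℂ) • ∑ i, V.mode (D.e (Sum.inr i) : W) (-1) (D.e (Sum.inr i) : W)
    + ∑ i, (1 / (2 * ((D.k i : ℂ) + D.h i))) •
        ∑ j, V.mode (D.y i j : W) (-1) (D.x i j : W)

/-- The vertex subalgebra `V(𝔞)` of `W` generated by `𝔞 = W(1)`. -/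
noncomputable def affineSubalgebra : Submodule ℂ W := V.subalgebraGeneratedBy (V.weightSpace 1)

/-- The image of the vertex subalgebra `U`, with distinguished vector the image of `ω ∈ U`, is
conformally embedded in the non-zero quotient `W/J` by the ideal `J`: the image of `ω` is the
conformal vector of `W/J`. -/
structure IsConformallyEmbeddedInQuotient (J U : Submodule ℂ W) (ω : W) : Prop where
  ideal : V.IsIdeal J
  proper : J ≠ ⊤
  mem : ω ∈ U
  conformal : J.mkQ ω = J.mkQ V.L

end ConformalVertexAlgebra

/-! Put ω = L - L^𝔞. Everything is decided by the operator ω(2), that is `mode ω 3`. It kills each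
:ab: with a, b ∈ 𝔞, hence kills L^𝔞, and this gives ω(2)ω = (c - c_𝔞)/2 · 1 (`mode_three_self`). If
c ≠ c_𝔞, every ideal containing ω contains the vacuum and is all of W.

Let c = c_𝔞. The span of all a_n ω is an ideal containing ω (`isIdeal_modeSpan`), and it is proper
once none of these vectors has a component in W(0). A product a_n ω of weight 0 with a ∈ W(N) has n
= N+1 and equals ω_(N+1) a up to sign, by skew-symmetry. That this vanishes is shown by induction on
N (`mode_eq_zero`): ω_(N) a lies in W(1), so L(1) kills it, while L(1)ω = 0 gives [L(1), ω_(N)] = (2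
- N) ω_(N+1). So ω_(N+1) a reduces to the same statement for L(1)a, except when N = 2. Strong
generation settles that weight (`three_eq_zero`): W(2) is spanned by the :ab:, the Ta, ω, and S ∩
W(2), all killed by ω(2).

The input on ω is the Sugawara construction: L^𝔞 acts on the currents of 𝔞 like L, except on the
isotropic vectors of 𝔞_0, which it does not see. These span the radical of 𝔞_0 and are orthogonal to
all of 𝔞, so the defect is harmless. This is what `IsCosetVector` records. -/

theorem finsum_eq_sum_range_of_forall_ge {M : Type*} [AddCommMonoid M] {f : ℕ → M} {N : ℕ}
    (h : ∀ j ≥ N, f j = 0) : ∑ᶠ j, f j = ∑ j ∈ Finset.range N, f j := by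
  refine finsum_eq_sum_of_support_subset _ fun j hj => ?_
  by_contra hc
  exact hj (h j (by simpa using hc))

/-! ### Signs and binomial coefficients. -/

theorem koszulSign_zero_left (q : ZMod 2) : koszulSign 0 q = 1 := by simp [koszulSign]

theorem koszulSign_zero_right (q : ZMod 2) : koszulSign q 0 = 1 := by simp [koszulSign]

theorem koszulSign_one_one : koszulSign 1 1 = -1 := by
  simp [koszulSign, show ((1 : ZMod 2).val) = 1 from rfl]

theorem koszulSign_mul_self (p q : ZMod 2) : koszulSign p q * koszulSign p q = 1 := by
  rw [koszulSign, ← mul_pow]; simp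

theorem zmod_two_eq (p : ZMod 2) : p = 0 ∨ p = 1 := by revert p; decide

theorem intCast_choose_neg_one (j : ℕ) : ((Ring.choose (-1 : ℤ) j : ℤ) : ℂ) = (-1) ^ j := by
  rw [Ring.choose_neg', Ring.multichoose_one, Int.negOnePow_def, Units.smul_def]
  simp

theorem intCast_choose_neg_two (j : ℕ) :
    ((Ring.choose (-2 : ℤ) j : ℤ) : ℂ) = (-1) ^ j * (j + 1) := by
  rw [Ring.choose_neg', Ring.multichoose_two, Int.negOnePow_def, Units.smul_def]
  simp

theorem intCast_choose_zero (j : ℕ) :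
    ((Ring.choose (0 : ℤ) j : ℤ) : ℂ) = if j = 0 then 1 else 0 := by
  rcases j with _ | j <;> simp

namespace VertexSuperalgebra

variable {W : Type*} [AddCommGroup W] [Module ℂ W] (V : VertexSuperalgebra W)

section Linearity

theorem mode_add (a b : W) (n : ℤ) : V.mode (a + b) n = V.mode a n + V.mode b n := by
  simp [mode]

theorem mode_sub (a b : W) (n : ℤ) : V.mode (a - b) n = V.mode a n - V.mode b n := by
  simp [mode]

theorem mode_zero (n : ℤ) : V.mode 0 n = 0 := by
  simp [mode]

theorem mode_smul (r : ℂ) (a : W) (n : ℤ) : V.mode (r • a) n = r • V.mode a n := by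
  simp [mode]

/-- The `n`-th product as a bilinear map. -/
noncomputable def product (n : ℤ) : W →ₗ[ℂ] W →ₗ[ℂ] W where
  toFun a := V.mode a n
  map_add' a b := V.mode_add a b n
  map_smul' r a := V.mode_smul r a n

theorem product_apply (n : ℤ) (a b : W) : V.product n a b = V.mode a n b := rfl

end Linearity

/-! ### Parity and Koszul signs. -/

section Parity

theorem exists_parity (a : W) : ∃ a₀ ∈ V.parity 0, ∃ a₁ ∈ V.parity 1, a = a₀ + a₁ := by
  have h : a ∈ V.parity 0 ⊔ V.parity 1 := by rw [V.isCompl_parity.sup_eq_top]; trivial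
  obtain ⟨a₀, h₀, a₁, h₁, rfl⟩ := Submodule.mem_sup.1 h
  exact ⟨a₀, h₀, a₁, h₁, rfl⟩

theorem parity_induction {P : W → Prop} (hadd : ∀ a b, P a → P b → P (a + b))
    (hom : ∀ p, ∀ a ∈ V.parity p, P a) (a : W) : P a := by
  obtain ⟨a₀, h₀, a₁, h₁, rfl⟩ := V.exists_parity a
  exact hadd _ _ (hom _ _ h₀) (hom _ _ h₁)

theorem eq_zero_of_mem_parity {p q : ZMod 2} (hpq : p ≠ q) {a : W} (hp : a ∈ V.parity p)
    (hq : a ∈ V.parity q) : a = 0 := by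
  have := V.isCompl_parity.disjoint
  rcases zmod_two_eq p with rfl | rfl <;> rcases zmod_two_eq q with rfl | rfl
  · exact absurd rfl hpq
  · exact Submodule.disjoint_def.1 this _ hp hq
  · exact Submodule.disjoint_def.1 this _ hq hp
  · exact absurd rfl hpq

theorem eq_zero_of_add_eq_zero {p q : ZMod 2} (hpq : p ≠ q) {a b : W} (hp : a ∈ V.parity p)
    (hq : b ∈ V.parity q) (h : a + b = 0) : a = 0 ∧ b = 0 := by
  have hab : a = -b := eq_neg_of_add_eq_zero_left h
  have ha : a = 0 := V.eq_zero_of_mem_parity hpq hp (hab ▸ (V.parity q).neg_mem hq)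
  exact ⟨ha, by simpa [ha] using h⟩

theorem mode_mem_parity {p q : ZMod 2} {a b : W} (ha : a ∈ V.parity p) (hb : b ∈ V.parity q)
    (n : ℤ) : V.mode a n b ∈ V.parity (p + q) := V.mode_parity p q a b n ha hb

/-- The parity automorphism, `1` on the even part and `-1` on the odd part. -/
noncomputable def parityAut : W →ₗ[ℂ] W :=
  (V.parity 0).projection (V.parity 1) V.isCompl_parity
    - (V.parity 1).projection (V.parity 0) V.isCompl_parity.symm

/-- The operator giving the Koszul sign for moving past a vector of parity `p`. -/
noncomputable def koszul (p : ZMod 2) : W →ₗ[ℂ] W := if p = 0 then LinearMap.id else V.parityAut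

theorem parityAut_even {a : W} (ha : a ∈ V.parity 0) : V.parityAut a = a := by
  simp only [parityAut, LinearMap.sub_apply]
  rw [Submodule.projection_apply_of_mem_left _ ha, Submodule.projection_apply_of_mem_right _ ha,
    sub_zero]

theorem parityAut_odd {a : W} (ha : a ∈ V.parity 1) : V.parityAut a = -a := by
  simp only [parityAut, LinearMap.sub_apply]
  rw [Submodule.projection_apply_of_mem_left _ ha, Submodule.projection_apply_of_mem_right _ ha,
    zero_sub]

theorem parityAut_of_mem {q : ZMod 2} {a : W} (ha : a ∈ V.parity q) :
    V.parityAut a = koszulSign 1 q • a := by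
  rcases zmod_two_eq q with rfl | rfl
  · simp [V.parityAut_even ha, koszulSign_zero_right]
  · simp [V.parityAut_odd ha, koszulSign_one_one]

theorem koszul_zero : V.koszul 0 = LinearMap.id := by simp [koszul]

theorem koszul_one : V.koszul 1 = V.parityAut := by simp [koszul]

theorem koszul_of_mem (p : ZMod 2) {q : ZMod 2} {a : W} (ha : a ∈ V.parity q) :
    V.koszul p a = koszulSign p q • a := by
  rcases zmod_two_eq p with rfl | rfl
  · simp [koszul_zero, koszulSign_zero_left]
  · rw [koszul_one, V.parityAut_of_mem ha]

theorem koszul_koszul (p : ZMod 2) (a : W) : V.koszul p (V.koszul p a) = a := by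
  refine V.parity_induction (P := fun a => V.koszul p (V.koszul p a) = a) ?_ ?_ a
  · intro a b ha hb; rw [map_add, map_add, ha, hb]
  · intro q a ha
    rw [V.koszul_of_mem p ha, map_smul, V.koszul_of_mem p ha, smul_smul, koszulSign_mul_self,
      one_smul]

theorem koszul_even (p : ZMod 2) {a : W} (ha : a ∈ V.parity 0) : V.koszul p a = a := by
  rw [V.koszul_of_mem p ha, koszulSign_zero_right, one_smul]

theorem mem_even_of_parityAut_eq {a : W} (h : V.parityAut a = a) : a ∈ V.parity 0 := by
  obtain ⟨a₀, h₀, a₁, h₁, rfl⟩ := V.exists_parity a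
  rw [map_add, V.parityAut_even h₀, V.parityAut_odd h₁] at h
  have h2 : (2 : ℂ) • a₁ = 0 := by
    rw [two_smul]
    have := add_left_cancel h
    exact (neg_eq_iff_add_eq_zero.1 this)
  have : a₁ = 0 := by simpa using h2
  simpa [this] using h₀

theorem parityAut_mode (a b : W) (n : ℤ) :
    V.parityAut (V.mode a n b) = V.mode (V.parityAut a) n (V.parityAut b) := by
  refine V.parity_induction
    (P := fun a => V.parityAut (V.mode a n b) = V.mode (V.parityAut a) n (V.parityAut b)) ?_ ?_ a
  · intro a a' h h'; simp [mode_add, h, h']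
  intro p a ha
  refine V.parity_induction
    (P := fun b => V.parityAut (V.mode a n b) = V.mode (V.parityAut a) n (V.parityAut b)) ?_ ?_ b
  · intro a a' h h'; simp [h, h']
  intro q b hb
  rw [V.parityAut_of_mem (V.mode_mem_parity ha hb n), V.parityAut_of_mem ha, V.parityAut_of_mem hb,
    mode_smul, LinearMap.smul_apply, map_smul, smul_smul]
  congr 1
  rcases zmod_two_eq p with rfl | rfl <;> rcases zmod_two_eq q with rfl | rfl <;>
    simp [koszulSign_zero_right, koszulSign_one_one, show (1 + 1 : ZMod 2) = 0 from rfl]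

/-- A graded subspace contains the homogeneous components of its elements. -/
theorem IsGraded.exists_parity {V : VertexSuperalgebra W} {U : Submodule ℂ W} (hU : V.IsGraded U)
    {a : W} (ha : a ∈ U) :
    ∃ a₀ ∈ U, ∃ a₁ ∈ U, a₀ ∈ V.parity 0 ∧ a₁ ∈ V.parity 1 ∧ a = a₀ + a₁ := by
  obtain ⟨a₀, h₀, a₁, h₁, rfl⟩ := Submodule.mem_sup.1 (hU ha)
  exact ⟨a₀, h₀.1, a₁, h₁.1, h₀.2, h₁.2, rfl⟩

theorem IsGraded.induction {V : VertexSuperalgebra W} {U : Submodule ℂ W} (hU : V.IsGraded U)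
    {P : W → Prop} (hadd : ∀ a b, P a → P b → P (a + b))
    (hom : ∀ p, ∀ a ∈ U, a ∈ V.parity p → P a) {a : W} (ha : a ∈ U) : P a := by
  obtain ⟨a₀, h₀, a₁, h₁, h₀', h₁', rfl⟩ := hU.exists_parity ha
  exact hadd _ _ (hom _ _ h₀ h₀') (hom _ _ h₁ h₁')

theorem IsGraded.koszul_mem {V : VertexSuperalgebra W} {U : Submodule ℂ W} (hU : V.IsGraded U)
    (p : ZMod 2) {a : W} (ha : a ∈ U) : V.koszul p a ∈ U := by
  refine hU.induction (P := fun a => V.koszul p a ∈ U) ?_ ?_ ha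
  · intro a b ha hb; rw [map_add]; exact U.add_mem ha hb
  · intro q a ha haq; rw [V.koszul_of_mem p haq]; exact U.smul_mem _ ha

end Parity

/-! ### Consequences of the Borcherds identity. -/

section Identities

theorem exists_mode_eq_zero (a b : W) : ∃ N : ℤ, ∀ n ≥ N, V.mode a n b = 0 := by
  refine ⟨-((HahnModule.of ℂ).symm (V.Y a b)).order, fun n hn => ?_⟩
  exact VertexOperator.ncoeff_eq_zero_of_lt_order _ _ _ (by omega)

theorem vac_mode_apply (n : ℤ) (b : W) : V.mode V.vac n b = if n = -1 then b else 0 :=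
  V.vac_mode n b

theorem mode_vac_neg (a : W) : V.mode a (-1) V.vac = a := V.mode_vac_neg_one a

theorem mode_vac_of_nonneg (a : W) {n : ℤ} (hn : 0 ≤ n) : V.mode a n V.vac = 0 :=
  V.mode_vac_nonneg a n hn

/-- Borcherds identity with n = 0. The sign is carried by the linear operator `koszul p`, so b need
not be homogeneous; this matters later because the dual bases are not assumed homogeneous. -/
theorem supercommutator {p : ZMod 2} {a : W} (ha : a ∈ V.parity p) (b c : W) (m k : ℤ) {N : ℕ}
    (hN : ∀ j : ℕ, N ≤ j → V.mode a j b = 0) :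
    V.mode a m (V.mode b k c) = V.mode (V.koszul p b) k (V.mode a m c)
      + ∑ j ∈ Finset.range N,
          ((Ring.choose m j : ℤ) : ℂ) • V.mode (V.mode a j b) (m + k - j) c := by
  have key : ∀ q, ∀ b ∈ V.parity q, (∀ j : ℕ, N ≤ j → V.mode a j b = 0) →
      V.mode a m (V.mode b k c) = V.mode (V.koszul p b) k (V.mode a m c)
      + ∑ j ∈ Finset.range N,
          ((Ring.choose m j : ℤ) : ℂ) • V.mode (V.mode a j b) (m + k - j) c := by
    intro q b hb hN
    have h := V.borcherds p q a b c m 0 k ha hb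
    rw [finsum_eq_sum_range_of_forall_ge (N := N),
      finsum_eq_sum_range_of_forall_ge (N := 1)] at h
    · simp only [zero_add, Finset.sum_range_one] at h
      simp only [← mode.eq_1] at h
      rw [h, V.koszul_of_mem p hb]
      simp [mode_smul]
    · intro j hj
      rw [intCast_choose_zero, if_neg (by omega)]; simp
    · intro j hj
      have := hN j hj
      rw [mode] at this
      simp [this]
  obtain ⟨b₀, h₀, b₁, h₁, rfl⟩ := V.exists_parity b
  -- The two components of a_j b have opposite parities, so both vanish when the sum does.
  have hz : ∀ j : ℕ, N ≤ j → V.mode a j b₀ = 0 ∧ V.mode a j b₁ = 0 := fun j hj =>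
    V.eq_zero_of_add_eq_zero (p := p + 0) (q := p + 1) (by simp) (V.mode_mem_parity ha h₀ _)
      (V.mode_mem_parity ha h₁ _) (by rw [← map_add]; exact hN j hj)
  simp only [mode_add, map_add, LinearMap.add_apply, smul_add, Finset.sum_add_distrib]
  rw [key 0 b₀ h₀ fun j hj => (hz j hj).1, key 1 b₁ h₁ fun j hj => (hz j hj).2]
  abel

theorem commutator_of_even {a : W} (ha : a ∈ V.parity 0) (b c : W) (m k : ℤ) {N : ℕ}
    (hN : ∀ j : ℕ, N ≤ j → V.mode a j b = 0) :
    V.mode a m (V.mode b k c) = V.mode b k (V.mode a m c)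
      + ∑ j ∈ Finset.range N,
          ((Ring.choose m j : ℤ) : ℂ) • V.mode (V.mode a j b) (m + k - j) c := by
  simpa [koszul_zero] using V.supercommutator ha b c m k hN

/-- Borcherds identity on the vacuum with m = -1, k = 0: nonnegative modes kill the vacuum, so only
b_n a survives on the right. -/
theorem skew_symmetry {p : ZMod 2} {a : W} (ha : a ∈ V.parity p) (b : W) (n : ℤ) {N : ℕ}
    (hN : ∀ j : ℕ, N ≤ j → V.mode a (n + j) b = 0) :
    V.mode (V.koszul p b) n a = -(-1 : ℂ) ^ n • ∑ j ∈ Finset.range N,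
      (-1 : ℂ) ^ j • V.mode (V.mode a (n + j) b) (-1 - j) V.vac := by
  have key : ∀ q, ∀ b ∈ V.parity q, (∀ j : ℕ, N ≤ j → V.mode a (n + j) b = 0) →
      V.mode (V.koszul p b) n a = -(-1 : ℂ) ^ n • ∑ j ∈ Finset.range N,
      (-1 : ℂ) ^ j • V.mode (V.mode a (n + j) b) (-1 - j) V.vac := by
    intro q b hb hN
    have h := V.borcherds p q a b V.vac (-1) n 0 ha hb
    rw [finsum_eq_sum_range_of_forall_ge (N := N),
      finsum_eq_sum_range_of_forall_ge (N := 1)] at h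
    · simp only [Finset.sum_range_one, intCast_choose_neg_one] at h
      simp only [← mode.eq_1, add_zero, Nat.cast_zero, sub_zero, pow_zero] at h
      rw [h, V.koszul_of_mem p hb]
      rw [V.mode_vac_of_nonneg b le_rfl, V.mode_vac_neg, map_zero]
      have hsq : ((-1 : ℂ) ^ n) * (-1 : ℂ) ^ n = 1 := by
        rw [← mul_zpow]; simp
      simp only [Ring.choose_zero_right, Int.cast_one, mul_one, zero_sub, mode_smul,
        LinearMap.smul_apply, smul_neg, smul_smul]
      rw [← neg_smul]
      congr 1
      linear_combination (-koszulSign p q) * hsq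
    · intro j hj
      simp only [← mode.eq_1]
      rw [V.mode_vac_of_nonneg b (by omega), V.mode_vac_of_nonneg a (by omega)]; simp
    · intro j hj
      have := hN j hj
      rw [mode] at this
      simp [this]
  obtain ⟨b₀, h₀, b₁, h₁, rfl⟩ := V.exists_parity b
  have hz : ∀ j : ℕ, N ≤ j → V.mode a (n + j) b₀ = 0 ∧ V.mode a (n + j) b₁ = 0 := fun j hj =>
    V.eq_zero_of_add_eq_zero (p := p + 0) (q := p + 1) (by simp) (V.mode_mem_parity ha h₀ _)
      (V.mode_mem_parity ha h₁ _) (by rw [← map_add]; exact hN j hj)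
  simp only [mode_add, map_add, LinearMap.add_apply, smul_add, Finset.sum_add_distrib]
  rw [key 0 b₀ h₀ fun j hj => (hz j hj).1, key 1 b₁ h₁ fun j hj => (hz j hj).2]

theorem T_mode (a b : W) (k : ℤ) : V.mode (V.T a) k b = (-k : ℂ) • V.mode a (k - 1) b := by
  refine V.parity_induction
    (P := fun a => V.mode (V.T a) k b = (-k : ℂ) • V.mode a (k - 1) b) ?_ ?_ a
  · intro a a' h h'
    simp only [T, mode_add, LinearMap.add_apply, smul_add] at h h' ⊢
    rw [h, h']
  intro p a ha
  -- The modes of the vacuum are δ_{n,-1}, so one index survives: j = -1-k in the first term if k <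
  -- 0, j = k-1 in the second if k > 0, none if k = 0.
  have h := V.borcherds p 0 a V.vac b 0 (-2) k ha V.vac_even
  rw [finsum_eq_single _ 0 fun j hj => by rw [intCast_choose_zero, if_neg hj]; simp] at h
  rw [Ring.choose_zero_right, Int.cast_one, one_smul] at h
  simp only [← mode.eq_1, Nat.cast_zero, add_zero, sub_zero, zero_add, vac_mode_apply,
    intCast_choose_neg_two, koszulSign_zero_right] at h
  rw [T, h]
  rcases lt_trichotomy k 0 with hk | rfl | hk
  · obtain ⟨j, hj⟩ : ∃ j : ℕ, (j : ℤ) = -1 - k := ⟨(-1 - k).toNat, by omega⟩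
    rw [finsum_eq_single _ j]
    · rw [if_pos (by omega), if_neg (by omega), show -2 - (j : ℤ) = k - 1 by omega]
      have : (k : ℂ) = -1 - j := by rw [show k = -1 - (j : ℤ) by omega]; push_cast; ring
      rw [smul_zero, sub_zero, this, ← mul_assoc, ← mul_pow]
      simp
    · intro i hi
      rw [if_neg (by omega), if_neg (by omega)]; simp
  · rw [finsum_eq_zero_of_forall_eq_zero]
    · simp
    · intro i
      rw [if_neg (by omega), if_neg (by omega)]; simp
  · obtain ⟨j, hj⟩ : ∃ j : ℕ, (j : ℤ) = k - 1 := ⟨(k - 1).toNat, by omega⟩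
    rw [finsum_eq_single _ j]
    · rw [if_neg (by omega), if_pos (by omega), hj]
      have : (k : ℂ) = j + 1 := by rw [show k = (j : ℤ) + 1 by omega]; push_cast; ring
      rw [map_zero, zero_sub, this, ← mul_assoc, ← mul_pow]
      simp
      module
    · intro i hi
      rw [if_neg (by omega), if_neg (by omega)]; simp

end Identities

end VertexSuperalgebra
namespace VertexSuperalgebra

variable {W : Type*} [AddCommGroup W] [Module ℂ W] (V : VertexSuperalgebra W)

/-! ### Ideals and the left submodule generated by a vector. -/

section Ideals

theorem T_vac : V.T V.vac = 0 := by simp [T, vac_mode_apply]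

/-- Up to the factor j!, x_(-1-j) 1 is T^j x. -/
theorem mode_vac_mem {U : Submodule ℂ W} (hT : ∀ x ∈ U, V.T x ∈ U) {x : W} (hx : x ∈ U) (j : ℕ) :
    V.mode x (-1 - j) V.vac ∈ U := by
  induction j generalizing x with
  | zero => simpa [mode_vac_neg] using hx
  | succ j ih =>
    have h := ih (hT x hx)
    rw [T_mode] at h
    have hj : (-((-1 - j : ℤ) : ℂ)) ≠ 0 := by
      push_cast
      have : ((j : ℂ) + 1) ≠ 0 := by exact_mod_cast Nat.succ_ne_zero j
      intro h0; apply this; linear_combination h0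
    have h' := U.smul_mem (-((-1 - j : ℤ) : ℂ))⁻¹ h
    rw [smul_smul, inv_mul_cancel₀ hj, one_smul] at h'
    rw [show (-1 - ((j + 1 : ℕ) : ℤ)) = -1 - j - 1 by push_cast; ring]
    exact h'

/-- The left submodule generated by a vector, spanned by its images under all modes. -/
def modeSpan (v : W) : Submodule ℂ W := Submodule.span ℂ {u | ∃ (a : W) (n : ℤ), u = V.mode a n v}

theorem mode_mem_modeSpan (v a : W) (n : ℤ) : V.mode a n v ∈ V.modeSpan v :=
  Submodule.subset_span ⟨a, n, rfl⟩

theorem self_mem_modeSpan (v : W) : v ∈ V.modeSpan v := by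
  simpa [vac_mode_apply] using V.mode_mem_modeSpan v V.vac (-1)

/-- Descending induction on k, starting where b_k v = 0. In the Borcherds identity with m so large
that a_(m+j) v = 0, and n - m in place of n, the left side is in the span and the right side is a_n
b_k v plus terms with b_(k+j), j ≥ 1. -/
theorem mode_mode_mem_modeSpan {p q : ZMod 2} {a b : W} (ha : a ∈ V.parity p) (hb : b ∈ V.parity q)
    (v : W) (n k : ℤ) : V.mode a n (V.mode b k v) ∈ V.modeSpan v := by
  obtain ⟨m, hm⟩ := V.exists_mode_eq_zero a v
  obtain ⟨k₀, hk₀⟩ := V.exists_mode_eq_zero b v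
  have key : ∀ (d : ℕ) (k n : ℤ), k₀ ≤ k + d → V.mode a n (V.mode b k v) ∈ V.modeSpan v := by
    intro d
    induction d with
    | zero => intro k n hk; rw [hk₀ k (by simpa using hk), map_zero]; exact zero_mem _
    | succ d ih =>
      intro k n hk
      have h := V.borcherds p q a b v m (n - m) k ha hb
      have hL : (∑ᶠ j : ℕ, ((Ring.choose m j : ℤ) : ℂ) •
          V.mode (V.mode a (n - m + j) b) (m + k - j) v) ∈ V.modeSpan v :=
        finsum_induction (· ∈ V.modeSpan v) (zero_mem _) (fun _ _ => add_mem)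
          fun j => Submodule.smul_mem _ _ (V.mode_mem_modeSpan _ _ _)
      simp only [← mode.eq_1] at h
      rw [h, finsum_eq_sum_range_of_forall_ge (N := d + 1), Finset.sum_range_succ'] at hL
      · have hrest := Submodule.sum_mem (V.modeSpan v) (t := Finset.range d)
          (f := fun j : ℕ => ((-1 : ℂ) ^ (j + 1) * ((Ring.choose (n - m) (j + 1) : ℤ) : ℂ)) •
            (V.mode a (m + (n - m) - (j + 1 : ℕ)) (V.mode b (k + (j + 1 : ℕ)) v)
              - (koszulSign p q * (-1 : ℂ) ^ (n - m)) •
                V.mode b (n - m + k - (j + 1 : ℕ)) (V.mode a (m + (j + 1 : ℕ)) v)))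
          fun j _ => by
            rw [hm _ (by omega), map_zero, smul_zero, sub_zero]
            exact Submodule.smul_mem _ _ (ih _ _ (by push_cast; omega))
        have := (Submodule.add_mem_iff_right _ hrest).1 hL
        rw [hm _ (by omega)] at this
        simpa using this
      · intro j hj
        rw [hm (m + j) (by omega), hk₀ (k + j) (by omega)]; simp
  exact key (k₀ - k).toNat k n (by omega)

theorem mode_mem_modeSpan_of_mem (v a : W) (n : ℤ) {x : W} (hx : x ∈ V.modeSpan v) :
    V.mode a n x ∈ V.modeSpan v := by
  induction hx using Submodule.span_induction with
  | mem x hx =>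
    obtain ⟨b, k, rfl⟩ := hx
    refine V.parity_induction (P := fun a => V.mode a n (V.mode b k v) ∈ V.modeSpan v) ?_ ?_ a
    · intro a a' h h'; rw [mode_add]; exact add_mem h h'
    intro p a ha
    refine V.parity_induction (P := fun b => V.mode a n (V.mode b k v) ∈ V.modeSpan v) ?_ ?_ b
    · intro b b' h h'; rw [mode_add, LinearMap.add_apply, map_add]; exact add_mem h h'
    intro q b hb
    exact V.mode_mode_mem_modeSpan ha hb v n k
  | zero => rw [map_zero]; exact zero_mem _
  | add x y _ _ hx hy => rw [map_add]; exact add_mem hx hy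
  | smul r x _ hx => rw [map_smul]; exact Submodule.smul_mem _ _ hx

theorem isGraded_modeSpan {p : ZMod 2} {v : W} (hv : v ∈ V.parity p) :
    V.IsGraded (V.modeSpan v) := by
  refine Submodule.span_le.2 ?_
  rintro _ ⟨a, n, rfl⟩
  obtain ⟨a₀, h₀, a₁, h₁, rfl⟩ := V.exists_parity a
  rw [mode_add]
  have h₀' := V.mode_mem_parity h₀ hv n
  have h₁' := V.mode_mem_parity h₁ hv n
  have m₀ := V.mode_mem_modeSpan v a₀ n
  have m₁ := V.mode_mem_modeSpan v a₁ n
  rcases zmod_two_eq p with rfl | rfl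
  · exact Submodule.add_mem_sup ⟨m₀, h₀'⟩ ⟨m₁, h₁'⟩
  · rw [LinearMap.add_apply, add_comm]
    exact Submodule.add_mem_sup ⟨m₁, h₁'⟩ ⟨m₀, h₀'⟩

/-- A graded subspace stable under translation and all modes is an ideal. -/
theorem isIdeal_of_left {J : Submodule ℂ W} (hJ : V.IsGraded J) (hT : ∀ x ∈ J, V.T x ∈ J)
    (hleft : ∀ (a : W) (n : ℤ), ∀ x ∈ J, V.mode a n x ∈ J) : V.IsIdeal J where
  graded := hJ
  translation := hT
  left := hleft
  -- Skew-symmetry writes x_n a through the T-derivatives of the products a_j x.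
  right a n x hx := by
    refine V.parity_induction (P := fun a => V.mode x n a ∈ J) ?_ ?_ a
    · intro a b h h'; rw [map_add]; exact add_mem h h'
    intro p a ha
    obtain ⟨N, hN⟩ := V.exists_mode_eq_zero a (V.koszul p x)
    rw [← V.koszul_koszul p x, V.skew_symmetry ha (V.koszul p x) n (N := (N - n).toNat)
      fun j hj => hN _ (by omega)]
    exact J.smul_mem _ (J.sum_mem fun j _ => J.smul_mem _
      (V.mode_vac_mem hT (hleft _ _ _ (hJ.koszul_mem p hx)) j))

theorem eq_top_of_vac_mem {J : Submodule ℂ W} (hJ : V.IsIdeal J) (h : V.vac ∈ J) : J = ⊤ := by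
  refine eq_top_iff.2 fun a _ => ?_
  simpa [vac_mode_apply] using hJ.right a (-1) V.vac h

theorem idealGeneratedBy_le {J : Submodule ℂ W} (hJ : V.IsIdeal J) {v : W} (hv : v ∈ J) :
    V.idealGeneratedBy v ≤ J := sInf_le ⟨hJ, hv⟩

end Ideals
end VertexSuperalgebra

/-- Transfer of adjoint operators across the canonical tensor of a bilinear form. -/
theorem sum_dual_basis_adjoint {ι M N : Type*} [Fintype ι] [AddCommGroup M] [Module ℂ M]
    [AddCommGroup N] [Module ℂ N] {B : LinearMap.BilinForm ℂ M} {x y : ι → M}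
    (hx : ∀ v, v = ∑ j, B v (y j) • x j) (hy : ∀ v, v = ∑ j, B (x j) v • y j)
    {A A' : M →ₗ[ℂ] M} (hA : ∀ u v, B (A u) v = B u (A' v)) (f : M →ₗ[ℂ] M →ₗ[ℂ] N) :
    ∑ j, f (y j) (A (x j)) = ∑ j, f (A' (y j)) (x j) := by
  calc ∑ j, f (y j) (A (x j)) = ∑ j, ∑ l, B (x j) (A' (y l)) • f (y j) (x l) := by
        refine Finset.sum_congr rfl fun j _ => ?_
        conv_lhs => rw [hx (A (x j))]
        simp [hA]
    _ = ∑ l, f (A' (y l)) (x l) := by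
        rw [Finset.sum_comm]
        refine Finset.sum_congr rfl fun l _ => ?_
        conv_rhs => rw [hy (A' (y l))]
        simp

/-! ### The Sugawara construction for a single perfect summand. -/

namespace VertexSuperalgebra

variable {W : Type*} [AddCommGroup W] [Module ℂ W] (V : VertexSuperalgebra W)

/-- The action of a mode on a normally ordered product of two vectors. -/
theorem mode_normal {p : ZMod 2} {z : W} (hz : z ∈ V.parity p) {y : W}
    (hy : ∀ n : ℕ, 2 ≤ n → V.mode z n y = 0) (x : W) (n : ℤ) :
    V.mode z n (V.mode y (-1) x) = V.mode (V.koszul p y) (-1) (V.mode z n x)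
      + V.mode (V.mode z 0 y) (n - 1) x + (n : ℂ) • V.mode (V.mode z 1 y) (n - 2) x := by
  rw [V.supercommutator hz y x n (-1) (N := 2) hy]
  simp [Finset.sum_range_succ, ← add_assoc, sub_eq_add_neg]
  norm_num [add_assoc]

theorem mode_normal_eq_zero {p : ZMod 2} {z : W} (hz : z ∈ V.parity p) {x y : W}
    (hy : ∀ n : ℕ, V.mode z n y = 0) (hx : ∀ n : ℕ, V.mode z n x = 0) (n : ℕ) :
    V.mode z n (V.mode y (-1) x) = 0 := by
  rw [V.mode_normal hz (fun n _ => hy n)]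
  have h0 := hy 0
  have h1 := hy 1
  push_cast at h0 h1
  rw [hx, h0, h1]; simp [mode_zero]

/-- If `S` is even and `a(z)S` has only a double pole with coefficient `r`, then `S(z)a` has the
singular part `∂r(w)/(z-w) + r(w)/(z-w)²`. -/
theorem mode_of_double_pole {p : ZMod 2} {a S r : W} (ha : a ∈ V.parity p) (hS : S ∈ V.parity 0)
    (h0 : V.mode a 0 S = 0) (h1 : V.mode a 1 S = r) (h2 : ∀ n : ℕ, 2 ≤ n → V.mode a n S = 0) :
    V.mode S 0 a = V.T r ∧ V.mode S 1 a = r ∧ ∀ n : ℕ, 2 ≤ n → V.mode S n a = 0 := by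
  have key : ∀ n : ℕ, V.mode S n a = -(-1 : ℂ) ^ n • ∑ j ∈ Finset.range 2,
      (-1 : ℂ) ^ j • V.mode (V.mode a (n + j) S) (-1 - j) V.vac := fun n => by
    have := V.skew_symmetry ha S n (N := 2) fun j hj => by exact_mod_cast h2 (n + j) (by omega)
    rwa [V.koszul_even p hS] at this
  refine ⟨?_, ?_, fun n hn => ?_⟩
  · have := key 0
    simp [Finset.sum_range_succ, h0, h1, mode_zero] at this
    simpa [T] using this
  · have := key 1
    have h2' := h2 2 le_rfl
    simp [Finset.sum_range_succ, h1, one_add_one_eq_two] at this h2'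
    simpa [h2', mode_zero, mode_vac_neg] using this
  · rw [key n]
    have h3 := h2 n hn
    have h4 := h2 (n + 1) (by omega)
    push_cast at h4
    simp [Finset.sum_range_succ, h3, h4, mode_zero]

/-- `𝔤` is a perfect Lie superalgebra of currents of level `k` for the invariant form `B`. -/
structure IsAffine (𝔤 : Submodule ℂ W) (B : LinearMap.BilinForm ℂ 𝔤) (k : ℂ) : Prop where
  form : V.IsInvariantForm 𝔤 B
  graded : V.IsGraded 𝔤
  closed : ∀ a ∈ 𝔤, ∀ b ∈ 𝔤, V.mode a 0 b ∈ 𝔤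
  perfect : 𝔤 ≤ Submodule.span ℂ {u | ∃ a ∈ 𝔤, ∃ b ∈ 𝔤, u = V.mode a 0 b}
  mode_one : ∀ a b : 𝔤, V.mode (a : W) 1 (b : W) = (k * B a b) • V.vac
  mode_ge_two : ∀ a ∈ 𝔤, ∀ b ∈ 𝔤, ∀ n : ℕ, 2 ≤ n → V.mode a n b = 0

namespace IsAffine

variable {V} {𝔤 : Submodule ℂ W} {B : LinearMap.BilinForm ℂ 𝔤} {k : ℂ} (h : V.IsAffine 𝔤 B k)

/-- The bracket `[a, b] = a₀ b`. -/
noncomputable def bracket : 𝔤 →ₗ[ℂ] 𝔤 →ₗ[ℂ] 𝔤 :=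
  LinearMap.mk₂ ℂ (fun a b => ⟨V.mode (a : W) 0 (b : W), h.closed _ a.2 _ b.2⟩)
    (fun a b c => Subtype.ext (by simp [mode_add])) (fun r a b => Subtype.ext (by simp [mode_smul]))
    (fun a b c => Subtype.ext (by simp)) (fun r a b => Subtype.ext (by simp))

theorem coe_bracket (a b : 𝔤) : (h.bracket a b : W) = V.mode (a : W) 0 (b : W) := rfl

/-- The Koszul sign operator restricted to `𝔤`. -/
noncomputable def koszul (p : ZMod 2) : 𝔤 →ₗ[ℂ] 𝔤 :=
  (V.koszul p).restrict fun _ ha => h.graded.koszul_mem p ha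

theorem coe_koszul (p : ZMod 2) (a : 𝔤) : (h.koszul p a : W) = V.koszul p a := rfl

theorem koszul_koszul (p : ZMod 2) (a : 𝔤) : h.koszul p (h.koszul p a) = a :=
  Subtype.ext (V.koszul_koszul p a)

theorem koszul_of_mem (p : ZMod 2) {q : ZMod 2} {a : 𝔤} (ha : (a : W) ∈ V.parity q) :
    h.koszul p a = koszulSign p q • a := Subtype.ext (V.koszul_of_mem p ha)

include h in
theorem induction {P : 𝔤 → Prop} (hadd : ∀ a b, P a → P b → P (a + b))
    (hom : ∀ p, ∀ a : 𝔤, (a : W) ∈ V.parity p → P a) (a : 𝔤) : P a := by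
  obtain ⟨a₀, h₀, a₁, h₁, h₀', h₁', ha⟩ := h.graded.exists_parity a.2
  have : a = ⟨a₀, h₀⟩ + ⟨a₁, h₁⟩ := Subtype.ext ha
  rw [this]
  exact hadd _ _ (hom 0 _ h₀') (hom 1 _ h₁')

theorem form_bracket (a b c : 𝔤) : B (h.bracket a b) c = B a (h.bracket b c) :=
  h.form.invariant a b c _ _ rfl rfl

/-- The sign depends only on the parity, and B pairs equal parities only. -/
theorem form_koszul_koszul (p : ZMod 2) (a b : 𝔤) : B (h.koszul p a) b = B a (h.koszul p b) := by
  refine h.induction (P := fun a => B (h.koszul p a) b = B a (h.koszul p b)) ?_ ?_ a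
  · intro a a' ha ha'; simp [ha, ha']
  intro q a ha
  refine h.induction (P := fun b => B (h.koszul p a) b = B a (h.koszul p b)) ?_ ?_ b
  · intro a a' ha ha'; simp [ha, ha']
  intro r b hb
  rw [h.koszul_of_mem p ha, h.koszul_of_mem p hb]
  by_cases hqr : q = r
  · subst hqr; simp
  · simp [h.form.even q r a b ha hb hqr]

theorem form_comm {p : ZMod 2} {z : 𝔤} (hz : (z : W) ∈ V.parity p) (x : 𝔤) :
    B z x = B (h.koszul p x) z := by
  refine h.induction (P := fun x => B z x = B (h.koszul p x) z) ?_ ?_ x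
  · intro a a' ha ha'; simp [ha, ha']
  intro q x hx
  rw [h.koszul_of_mem p hx, h.form.supersymmetric p q z x hz hx]
  simp

theorem bracket_comm {p : ZMod 2} {z : 𝔤} (hz : (z : W) ∈ V.parity p) (x : 𝔤) :
    h.bracket z x = -h.bracket (h.koszul p x) z := by
  apply Subtype.ext
  have := V.skew_symmetry hz (x : W) 0 (N := 2) fun j hj => by
    simpa using h.mode_ge_two z z.2 x x.2 j hj
  rw [Submodule.coe_neg, coe_bracket, coe_bracket, coe_koszul, this]
  simp [Finset.sum_range_succ, h.mode_one, mode_smul, vac_mode_apply, mode_vac_neg]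

theorem jacobi {p : ZMod 2} {z : 𝔤} (hz : (z : W) ∈ V.parity p) (x y : 𝔤) :
    h.bracket z (h.bracket y x) =
      h.bracket (h.koszul p y) (h.bracket z x) + h.bracket (h.bracket z y) x := by
  apply Subtype.ext
  have := V.supercommutator hz (y : W) (x : W) 0 0 (N := 1 + 1) fun j hj =>
    h.mode_ge_two z z.2 y y.2 j (by omega)
  simpa [Finset.sum_range_succ, intCast_choose_zero, coe_bracket, coe_koszul] using this

section DualBases

variable {ι : Type*} [Fintype ι] [DecidableEq ι] {x : Module.Basis ι ℂ 𝔤} {y : ι → 𝔤}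
  (hxy : ∀ j l, B (x j) (y l) = if j = l then 1 else 0)

include hxy

theorem eq_sum_left (v : 𝔤) : v = ∑ j, B v (y j) • x j := by
  conv_lhs => rw [← x.sum_repr v]
  refine Finset.sum_congr rfl fun j _ => ?_
  congr 1
  conv_rhs => rw [← x.sum_repr v]
  simp [hxy, -Module.Basis.sum_repr]

include h

theorem eq_sum_right (v : 𝔤) : v = ∑ j, B (x j) v • y j := by
  rw [← sub_eq_zero]
  refine h.form.nondegenerate.2 _ fun u => ?_
  rw [eq_sum_left hxy u]
  simp [hxy]

theorem sum_adjoint {N : Type*} [AddCommGroup N] [Module ℂ N] {A A' : 𝔤 →ₗ[ℂ] 𝔤}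
    (hA : ∀ u v, B (A u) v = B u (A' v)) (f : 𝔤 →ₗ[ℂ] 𝔤 →ₗ[ℂ] N) :
    ∑ j, f (y j) (A (x j)) = ∑ j, f (A' (y j)) (x j) :=
  sum_dual_basis_adjoint (eq_sum_left hxy) (eq_sum_right h hxy) hA f

/-- The canonical tensor is invariant under `𝔤`. -/
theorem sum_invariant {N : Type*} [AddCommGroup N] [Module ℂ N] {p : ZMod 2} {z : 𝔤}
    (hz : (z : W) ∈ V.parity p) (f : 𝔤 →ₗ[ℂ] 𝔤 →ₗ[ℂ] N) :
    ∑ j, f (h.koszul p (y j)) (h.bracket z (x j)) + ∑ j, f (h.bracket z (y j)) (x j) = 0 := by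
  -- Skew-symmetry and invariance give B([z,u],v) = -B(κu,[z,v]) = -B(u,κ[z,v]), κ being the Koszul
  -- operator; this is the adjoint of ad z.
  have := sum_adjoint h hxy (A := h.bracket z) (A' := -(h.koszul p ∘ₗ h.bracket z))
    (fun u v => by
      rw [h.bracket_comm hz, map_neg, LinearMap.neg_apply, h.form_bracket, h.form_koszul_koszul]
      simp) (f ∘ₗ h.koszul p)
  simp only [LinearMap.comp_apply, LinearMap.neg_apply, map_neg, koszul_koszul,
    Finset.sum_neg_distrib] at this
  rw [this, neg_add_cancel]

/-- The sum v is killed by every ad z, by invariance of the canonical tensor. Then B([a,b],v) =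
B(a,[b,v]) = 0, and perfectness with nondegeneracy forces v = 0. -/
theorem sum_bracket : ∑ j, h.bracket (y j) (x j) = 0 := by
  set v := ∑ j, h.bracket (y j) (x j) with hv
  have hz : ∀ z, h.bracket z v = 0 := by
    refine h.induction (fun a b ha hb => by rw [map_add, LinearMap.add_apply, ha, hb, add_zero]) ?_
    intro p z hz
    rw [hv, map_sum, ← sum_invariant h hxy hz h.bracket, ← Finset.sum_add_distrib]
    exact Finset.sum_congr rfl fun j _ => h.jacobi hz _ _
  refine h.form.nondegenerate.2 _ fun u => ?_
  obtain ⟨u, hu⟩ := u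
  suffices ∀ u ∈ Submodule.span ℂ {u | ∃ a ∈ 𝔤, ∃ b ∈ 𝔤, u = V.mode a 0 b},
      ∀ hu : u ∈ 𝔤, B ⟨u, hu⟩ v = 0 from this u (h.perfect hu) hu
  intro u hu
  have hle : Submodule.span ℂ {u | ∃ a ∈ 𝔤, ∃ b ∈ 𝔤, u = V.mode a 0 b} ≤
      (LinearMap.ker (B.flip v)).map 𝔤.subtype := by
    refine Submodule.span_le.2 ?_
    rintro _ ⟨a, ha, b, hb, rfl⟩
    exact ⟨h.bracket ⟨a, ha⟩ ⟨b, hb⟩, by simp [h.form_bracket, hz], rfl⟩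
  obtain ⟨w, hw, rfl⟩ := hle hu
  exact fun _ => hw

/-- The (unnormalized) Sugawara vector is even. -/
theorem sum_normal_even :
    ∑ j, V.mode (y j : W) (-1) (x j : W) ∈ V.parity 0 := by
  apply V.mem_even_of_parityAut_eq
  simp_rw [map_sum, parityAut_mode, ← V.koszul_one, ← h.coe_koszul]
  -- The parity automorphism is self-adjoint for B and an involution, so it fixes the canonical
  -- tensor.
  have := sum_adjoint h hxy (h.form_koszul_koszul 1)
    (((V.product (-1)).domRestrict₁₂ 𝔤 𝔤) ∘ₗ h.koszul 1)
  simp only [LinearMap.comp_apply, h.koszul_koszul] at this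
  exact this

/-- The simple pole vanishes by invariance of the canonical tensor. In the double pole each
contraction with a single factor gives k z, and the double contraction gives the Casimir value 2h z.
-/
theorem mode_sum_normal {hc : ℂ}
    (cas : ∀ z : 𝔤, ∑ j, h.bracket (y j) (h.bracket (x j) z) = (2 * hc) • z)
    {p : ZMod 2} {z : 𝔤} (hz : (z : W) ∈ V.parity p) :
    V.mode (z : W) 0 (∑ j, V.mode (y j : W) (-1) (x j : W)) = 0 ∧
    V.mode (z : W) 1 (∑ j, V.mode (y j : W) (-1) (x j : W)) = (2 * (k + hc)) • (z : W) ∧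
    ∀ n : ℕ, 2 ≤ n → V.mode (z : W) n (∑ j, V.mode (y j : W) (-1) (x j : W)) = 0 := by
  have hn : ∀ n : ℤ, V.mode (z : W) n (∑ j, V.mode (y j : W) (-1) (x j : W)) =
      ∑ j, (V.mode (h.koszul p (y j) : W) (-1) (V.mode z n (x j))
        + V.mode (h.bracket z (y j) : W) (n - 1) (x j)
        + ((n : ℂ) * (k * B z (y j))) • V.mode V.vac (n - 2) (x j)) := fun n => by
    rw [map_sum]
    refine Finset.sum_congr rfl fun j _ => ?_
    rw [V.mode_normal hz (h.mode_ge_two z z.2 _ (y j).2), h.mode_one]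
    simp only [mode_smul, LinearMap.smul_apply, smul_smul, coe_koszul, coe_bracket]
  refine ⟨?_, ?_, fun n hn2 => ?_⟩
  · rw [hn]
    have := sum_invariant h hxy hz ((V.product (-1)).domRestrict₁₂ 𝔤 𝔤)
    rw [← Finset.sum_add_distrib] at this
    simpa [product_apply, coe_bracket, LinearMap.domRestrict₁₂_apply] using this
  · have h1 : ∑ j, V.mode (h.koszul p (y j) : W) (-1) (V.mode z 1 (x j)) = k • (z : W) := by
      have hzz := congrArg (fun u => (h.koszul p u : W)) (eq_sum_right h hxy (h.koszul p z))
      simp only [koszul_koszul, map_sum, map_smul, Submodule.coe_sum, Submodule.coe_smul] at hzz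
      conv_rhs => rw [hzz, Finset.smul_sum]
      refine Finset.sum_congr rfl fun j _ => ?_
      rw [h.mode_one, map_smul, mode_vac_neg, smul_smul, h.form_comm hz, h.form_koszul_koszul]
    have h2 : ∑ j, V.mode (h.bracket z (y j) : W) 0 (x j) = (2 * hc) • (z : W) := by
      -- Pairing with u moves both brackets across: the left side becomes B(z, ∑ [y_j,[x_j,u]]), the
      -- Casimir acting on u.
      have : ∑ j, h.bracket (h.bracket z (y j)) (x j) = (2 * hc) • z := by
        rw [← sub_eq_zero]
        refine h.form.nondegenerate.1 _ fun u => ?_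
        have := congrArg (B z) (cas u)
        simp only [map_sum, map_sub, LinearMap.sub_apply, LinearMap.sum_apply, map_smul,
          LinearMap.smul_apply, h.form_bracket] at this ⊢
        rw [this, sub_self]
      simpa [coe_bracket] using congrArg (Subtype.val) this
    have h3 : ∑ j, (k * B z (y j)) • (x j : W) = k • (z : W) := by
      conv_rhs => rw [eq_sum_left hxy z]
      simp [Finset.smul_sum, smul_smul]
    rw [hn]
    simp only [sub_self, Finset.sum_add_distrib, h1, h2, vac_mode_apply]
    norm_num
    rw [h3]
    module
  · rw [hn]
    -- For n = 2 what remains is k ∑ B([z,y_j],x_j) = k B(z, ∑ [y_j,x_j]) = 0; for n ≥ 3 every term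
    -- is zero by weight.
    obtain rfl | hn3 := hn2.eq_or_lt
    · have : ∑ j, B (h.bracket z (y j)) (x j) = 0 := by
        simp_rw [h.form_bracket]
        rw [← map_sum, sum_bracket h hxy, map_zero]
      have h2 : ∀ j, V.mode (z : W) (2 : ℕ) (x j : W) = 0 := fun j =>
        h.mode_ge_two z z.2 _ (x j).2 2 le_rfl
      simp only [h2, map_zero, zero_add, vac_mode_apply]
      norm_num
      simp only [h.mode_one]
      rw [← Finset.sum_smul, ← Finset.mul_sum, this]
      simp
    · refine Finset.sum_eq_zero fun j _ => ?_
      have h3 := h.mode_ge_two _ (h.bracket z (y j)).2 _ (x j).2 (n - 1) (by omega)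
      rw [Nat.cast_sub (by omega), Nat.cast_one] at h3
      rw [h.mode_ge_two z z.2 _ (x j).2 n hn2, map_zero, h3, vac_mode_apply, if_neg (by omega)]
      simp

end DualBases

end IsAffine

end VertexSuperalgebra

namespace VertexSuperalgebra

variable {W : Type*} [AddCommGroup W] [Module ℂ W] (V : VertexSuperalgebra W)

theorem commutator_of_even_nat {a : W} (ha : a ∈ V.parity 0) (b c : W) (m : ℕ) (k : ℤ) :
    V.mode a m (V.mode b k c) = V.mode b k (V.mode a m c)
      + ∑ j ∈ Finset.range (m + 1), (m.choose j : ℂ) • V.mode (V.mode a j b) (m + k - j) c := by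
  obtain ⟨N, hN⟩ := V.exists_mode_eq_zero a b
  rw [V.commutator_of_even ha b c m k (N := m + 1 + N.toNat) fun j hj => hN j (by omega)]
  congr 1
  simp_rw [Ring.choose_natCast, Int.cast_natCast]
  refine (Finset.sum_subset (Finset.range_mono (by omega)) fun j _ hj => ?_).symm
  rw [Nat.choose_eq_zero_of_lt (by simpa using hj)]; simp

theorem T_smul (r : ℂ) (a : W) : V.T (r • a) = r • V.T a := by simp [T, mode_smul]

theorem T_add (a b : W) : V.T (a + b) = V.T a + V.T b := by simp [T, mode_add]

theorem T_zero : V.T 0 = 0 := by simp [T, mode_zero]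

end VertexSuperalgebra

namespace ConformalVertexAlgebra

open VertexSuperalgebra

variable {W : Type*} [AddCommGroup W] [Module ℂ W] (V : ConformalVertexAlgebra W)

/-! ### Conformal weights. -/

section Weights

theorem mem_weightSpace {a : W} {Δ : ℂ} : a ∈ V.weightSpace Δ ↔ V.mode V.L 1 a = Δ • a :=
  Module.End.mem_eigenspace_iff

theorem mode_mem_weightSpace_sub {a : W} {α : ℂ} (ha : a ∈ V.weightSpace α) {b : W} {β : ℂ}
    (hb : b ∈ V.weightSpace β) (n : ℤ) : V.mode a n b ∈ V.weightSpace (α + β - n - 1) := by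
  rw [mem_weightSpace] at *
  have h := V.commutator_of_even_nat V.L_even a b 1 n
  simp only [Finset.sum_range_succ, Finset.sum_range_zero, zero_add, Nat.choose_zero_right,
    Nat.choose_one_right, Nat.cast_zero, Nat.cast_one, one_smul, V.L_neg_one, T_mode, ha, hb,
    mode_smul, LinearMap.smul_apply, map_smul, sub_zero] at h
  rw [h, show (1 + n - 1 : ℤ) = n by ring]
  push_cast
  module

theorem mode_mem_weightSpace {a b : W} {α β γ : ℂ} (ha : a ∈ V.weightSpace α)
    (hb : b ∈ V.weightSpace β) {n : ℤ} (h : α + β - n - 1 = γ) :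
    V.mode a n b ∈ V.weightSpace γ := h ▸ V.mode_mem_weightSpace_sub ha hb n

theorem vac_mem_weightSpace : V.vac ∈ V.weightSpace 0 := by
  rw [weightSpace, V.eigenspace_zero]; exact Submodule.mem_span_singleton_self _

theorem exists_smul_vac {a : W} (ha : a ∈ V.weightSpace 0) : ∃ r : ℂ, a = r • V.vac := by
  rw [weightSpace, V.eigenspace_zero, Submodule.mem_span_singleton] at ha
  obtain ⟨r, rfl⟩ := ha
  exact ⟨r, rfl⟩

theorem T_mem_weightSpace {a : W} {α : ℂ} (ha : a ∈ V.weightSpace α) :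
    V.T a ∈ V.weightSpace (α + 1) :=
  V.mode_mem_weightSpace ha V.vac_mem_weightSpace (by push_cast; ring)

theorem T_iterate_mem_weightSpace {a : W} {α : ℂ} (ha : a ∈ V.weightSpace α) (j : ℕ) :
    V.T^[j] a ∈ V.weightSpace (α + j) := by
  induction j with
  | zero => simpa using ha
  | succ j ih =>
    rw [Function.iterate_succ_apply', Nat.cast_succ, ← add_assoc]
    exact V.T_mem_weightSpace ih

theorem iSupIndep_weightSpace : iSupIndep V.weightSpace := Module.End.eigenspaces_iSupIndep _

theorem iSup_weightSpace : ⨆ n : ℕ, V.weightSpace ((n : ℂ) / 2) = ⊤ := V.iSup_eigenspace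

/-- The eigenspaces for half-integers n/2, n ≥ 0, already fill W, and an eigenspace is independent
of the sum of the others. -/
theorem weightSpace_eq_bot {Δ : ℂ} (h : ∀ n : ℕ, Δ ≠ (n : ℂ) / 2) : V.weightSpace Δ = ⊥ := by
  have h1 := V.iSupIndep_weightSpace Δ
  have h2 : ⊤ ≤ ⨆ δ, ⨆ (_ : δ ≠ Δ), V.weightSpace δ := by
    rw [← V.iSup_weightSpace]
    exact iSup_le fun n => le_iSup₂_of_le ((n : ℂ) / 2) (h n).symm le_rfl
  rw [top_le_iff.1 h2, disjoint_top] at h1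
  exact h1

theorem weightSpace_neg {z : ℤ} (hz : z < 0) : V.weightSpace (z : ℂ) = ⊥ := by
  refine V.weightSpace_eq_bot fun n hn => ?_
  have : (2 * z : ℂ) = n := by rw [hn]; ring
  have : 2 * z = (n : ℤ) := by exact_mod_cast this
  omega

theorem eq_zero_of_mem_weightSpace {a : W} {z : ℤ} {α : ℂ} (hz : z < 0) (hα : α = z)
    (ha : a ∈ V.weightSpace α) : a = 0 := by
  rw [hα, V.weightSpace_neg hz] at ha
  simpa using ha

theorem mode_ge_two_eq_zero {a b : W} (ha : a ∈ V.weightSpace 1) (hb : b ∈ V.weightSpace 1)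
    (n : ℕ) (hn : 2 ≤ n) : V.mode a n b = 0 :=
  V.eq_zero_of_mem_weightSpace (z := 1 - n) (by omega) rfl
    (V.mode_mem_weightSpace ha hb (by push_cast; ring))

theorem exists_mode_one {a b : W} (ha : a ∈ V.weightSpace 1) (hb : b ∈ V.weightSpace 1) :
    ∃ r : ℂ, V.mode a 1 b = r • V.vac :=
  V.exists_smul_vac (V.mode_mem_weightSpace ha hb (by push_cast; ring))

end Weights

/-! ### Products with the conformal vector. -/

section Virasoro

theorem L_mem_weightSpace : V.L ∈ V.weightSpace 2 := by
  rw [mem_weightSpace]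
  -- L = L(-2)1, so each product L_n L is a Virasoro commutator applied to the vacuum.
  have h := V.virasoro 0 (-2) V.vac
  norm_num [mode_vac_neg, mode_vac_of_nonneg] at h
  exact h

theorem L_two_L : V.mode V.L 2 V.L = 0 := by
  have h := V.virasoro 1 (-2) V.vac
  norm_num [mode_vac_neg, mode_vac_of_nonneg] at h
  exact h

theorem L_three_L : V.mode V.L 3 V.L = (V.c / 2) • V.vac := by
  have h := V.virasoro 2 (-2) V.vac
  norm_num [mode_vac_neg, mode_vac_of_nonneg] at h
  rw [h]
  congr 1
  ring

/-- The contributions are (L(-1)a)_1 b = -a_0 b and 2(L(0)a)_0 b = 2 a_0 b; the others vanish by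
primarity. -/
theorem L_mode_normal {a b : W} (ha : a ∈ V.weightSpace 1)
    (hpa : V.IsPrimary a) (hpb : V.IsPrimary b) :
    V.mode V.L 2 (V.mode a (-1) b) = V.mode a 0 b := by
  have h := V.commutator_of_even_nat V.L_even a b 2 (-1)
  have ha1 := V.mem_weightSpace.1 ha
  have ha2 := hpa.2 1 one_pos
  have hb2 := hpb.2 1 one_pos
  norm_num at ha2 hb2
  simp [Finset.sum_range_succ, V.L_neg_one, T_mode, ha1, ha2, hb2, mode_zero] at h
  rw [h]
  module

end Virasoro

/-! ### Coset vectors and properness of the ideal they generate. -/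

/-- A vector of weight two which behaves like the difference `L - L'` of the conformal vector and
the Sugawara vector: it commutes with the currents of `W(1)` up to the radical of the form. -/
structure IsCosetVector (ω : W) : Prop where
  even : ω ∈ V.parity 0
  weight : ω ∈ V.weightSpace 2
  L_two : V.mode V.L 2 ω = 0
  current : ∀ a ∈ V.weightSpace 1, ∃ r ∈ V.weightSpace 1,
    (∀ b ∈ V.weightSpace 1, V.mode r 1 b = 0) ∧ V.mode ω 0 a = V.T r ∧ V.mode ω 1 a = r ∧
      ∀ n : ℕ, 2 ≤ n → V.mode ω n a = 0

namespace IsCosetVector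

variable {V} {ω : W} (hω : V.IsCosetVector ω)
include hω

/-- The contractions give (Tr)_2 b + 3 r_1 b = r_1 b, which is zero because r is in the radical of
the form. -/
theorem three_normal {a b : W} (ha : a ∈ V.weightSpace 1) (hb : b ∈ V.weightSpace 1) :
    V.mode ω 3 (V.mode a (-1) b) = 0 := by
  obtain ⟨r, -, hr, h0, h1, h2⟩ := hω.current a ha
  obtain ⟨_, -, -, -, -, hb2⟩ := hω.current b hb
  have hb3 := hb2 3 (by norm_num)
  have ha3 := h2 3 (by norm_num)
  have ha2 := h2 2 (by norm_num)
  have h := V.commutator_of_even_nat hω.even a b 3 (-1)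
  norm_num at hb3 ha3 ha2
  norm_num [Finset.sum_range_succ, h0, h1, ha2, ha3, hb3, mode_zero, T_mode, hr b hb] at h
  exact h

/-- [T, ω_3] = -3 ω_2, and both ω_2 and ω_3 kill a. -/
theorem three_T {a : W} (ha : a ∈ V.weightSpace 1) : V.mode ω 3 (V.T a) = 0 := by
  obtain ⟨r, -, hr, h0, h1, h2⟩ := hω.current a ha
  have ha3 := h2 3 (by norm_num)
  have ha2 := h2 2 (by norm_num)
  have h := V.commutator_of_even_nat V.L_even ω a 0 3
  norm_num at ha3 ha2
  norm_num [ha2, ha3, V.L_neg_one, T_mode, V.T_zero] at h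
  exact h.symm

/-- The induction of the overview: ω_(N) a ∈ W(1) is killed by L(1), which ties ω_(N+1) a to the
weight N-1 vector L(1)a. -/
theorem mode_eq_zero (h_primary : ∀ a ∈ V.weightSpace 1, V.IsPrimary a)
    (h2 : ∀ a ∈ V.weightSpace 2, V.mode ω 3 a = 0) (N : ℕ) {a : W} (ha : a ∈ V.weightSpace N) :
    V.mode ω (N + 1) a = 0 := by
  induction N generalizing a with
  | zero =>
    obtain ⟨r, rfl⟩ := V.exists_smul_vac (by simpa using ha)
    rw [map_smul, V.mode_vac_of_nonneg _ (by positivity), smul_zero]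
  | succ N ih =>
    obtain hN | hN := eq_or_ne (N + 1) 2
    · obtain rfl : N = 1 := by omega
      exact_mod_cast h2 a (by exact_mod_cast ha)
    have hL2 : V.mode V.L 2 a ∈ V.weightSpace N :=
      V.mode_mem_weightSpace V.L_mem_weightSpace ha (by push_cast; ring)
    have hω1 : V.mode ω (N + 1 : ℕ) a ∈ V.weightSpace 1 :=
      V.mode_mem_weightSpace hω.weight ha (by push_cast; ring)
    have h := V.commutator_of_even_nat V.L_even ω a 2 (N + 1 : ℕ)
    have hp := (h_primary _ hω1).2 1 one_pos
    have hih := ih hL2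
    have hw := V.mem_weightSpace.1 hω.weight
    have hl := hω.L_two
    have e1 : (2 : ℤ) + ((N + 1 : ℕ) : ℤ) - 1 = ((N + 1 : ℕ) : ℤ) + 1 := by ring
    norm_num at hp
    simp only [Finset.sum_range_succ, Finset.sum_range_zero, zero_add, Nat.choose_zero_right,
      Nat.cast_ofNat, Nat.choose_self, Nat.choose_one_right, Nat.cast_zero, Nat.cast_one, one_smul,
      V.L_neg_one, T_mode, hw, hl, mode_zero, LinearMap.zero_apply, add_zero, sub_zero, e1,
      mode_smul, LinearMap.smul_apply] at h
    push_cast at h hih hp ⊢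
    rw [hp, hih] at h
    -- The coefficient is -(N+3) from (Tω)_(N+3) plus 4 from 2(L(0)ω)_(N+2). It vanishes exactly
    -- when the weight N+1 is 2, the case treated separately.
    have h3 : ((1 : ℂ) - N) • V.mode ω ((N : ℤ) + 1 + 1) a = 0 := by
      refine Eq.trans ?_ h.symm
      module
    refine (smul_eq_zero.1 h3).resolve_left fun h0 => hN ?_
    have : (N : ℂ) = 1 := by linear_combination -h0
    have : N = 1 := by exact_mod_cast this
    omega

theorem isIdeal_modeSpan : V.IsIdeal (V.modeSpan ω) :=
  V.isIdeal_of_left (V.isGraded_modeSpan hω.even)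
    (fun x hx => by rw [← V.L_neg_one]; exact V.mode_mem_modeSpan_of_mem _ _ _ hx)
    fun a n x hx => V.mode_mem_modeSpan_of_mem _ _ _ hx

/-- The span lies in the sum of the nonzero weight spaces, which misses the vacuum. -/
theorem modeSpan_ne_top (h_primary : ∀ a ∈ V.weightSpace 1, V.IsPrimary a)
    (h2 : ∀ a ∈ V.weightSpace 2, V.mode ω 3 a = 0) : V.modeSpan ω ≠ ⊤ := by
  intro htop
  have hle : V.modeSpan ω ≤ ⨆ δ, ⨆ (_ : δ ≠ (0 : ℂ)), V.weightSpace δ := by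
    refine Submodule.span_le.2 ?_
    rintro _ ⟨a, n, rfl⟩
    have ha : a ∈ ⨆ n : ℕ, V.weightSpace ((n : ℂ) / 2) := by rw [V.iSup_weightSpace]; trivial
    induction ha using Submodule.iSup_induction' with
    | mem i a ha =>
      have hm := V.mode_mem_weightSpace_sub ha hω.weight n
      by_cases h0 : (i : ℂ) / 2 + 2 - n - 1 = 0
      · have hn : (i : ℤ) + 2 = 2 * n := by
          have : (i : ℂ) + 2 = 2 * n := by linear_combination 2 * h0
          exact_mod_cast this
        obtain ⟨N, rfl⟩ : ∃ N, i = 2 * N := ⟨i / 2, by omega⟩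
        obtain rfl : n = N + 1 := by push_cast at hn; omega
        have haN : a ∈ V.weightSpace N := by
          convert ha using 2; push_cast; ring
        have hz : ∀ j : ℕ, 1 ≤ j → V.mode ω ((N : ℤ) + 1 + j) a = 0 := fun j hj =>
          V.eq_zero_of_mem_weightSpace (z := -j) (by omega) rfl
            (V.mode_mem_weightSpace hω.weight haN (by push_cast; ring))
        have := V.skew_symmetry hω.even a ((N : ℤ) + 1) (N := 1) hz
        rw [koszul_zero] at this
        simp [hω.mode_eq_zero h_primary h2 N haN, mode_zero] at this
        rw [this]
        exact zero_mem _
      · exact le_iSup₂ (f := fun δ (_ : δ ≠ (0 : ℂ)) => V.weightSpace δ) _ h0 hm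
    | zero => rw [mode_zero]; exact zero_mem _
    | add a b _ _ ha hb => rw [mode_add]; exact add_mem ha hb
  exact V.vac_ne_zero (Submodule.disjoint_def.1 (V.iSupIndep_weightSpace 0) _
    V.vac_mem_weightSpace (hle (htop ▸ trivial)))

/-- Only monomials of weight 2 in the strong generators matter, and each type is killed by `mode ω
3`. -/
theorem three_eq_zero (h_half : V.weightSpace (1 / 2) = ⊥) (hωω : V.mode ω 3 ω = 0)
    {S : Set W} (hS : ∀ X ∈ S, ∃ n : ℕ, X ∈ V.weightSpace ((n : ℂ) / 2))
    (hgen : V.StronglyGenerates ((V.weightSpace 1 : Set W) ∪ ({ω} ∪ S)))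
    (hS2 : ∀ X ∈ S, X ∈ V.weightSpace 2 → V.mode ω 3 X = 0) {a : W} (ha : a ∈ V.weightSpace 2) :
    V.mode ω 3 a = 0 := by
  have hX : ∀ w ∈ ((V.weightSpace 1 : Set W) ∪ ({ω} ∪ S)), ∃ m : ℕ,
      w ∈ V.weightSpace ((m : ℂ) / 2) ∧ (m = 4 → V.mode ω 3 w = 0) := by
    rintro w (hw | rfl | hw)
    · exact ⟨2, by norm_num; exact hw, by norm_num⟩
    · exact ⟨4, by norm_num; exact hω.weight, fun _ => hωω⟩
    · obtain ⟨m, hm⟩ := hS w hw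
      refine ⟨m, hm, ?_⟩
      rintro rfl
      norm_num at hm
      exact hS2 w hw hm
  have hl : ∀ l : List (ℕ × W), (∀ t ∈ l, t.2 ∈ ((V.weightSpace 1 : Set W) ∪ ({ω} ∪ S))) →
      ∃ n : ℕ, V.normalOrderedProduct l ∈ V.weightSpace ((n : ℂ) / 2) ∧
        (n = 4 → V.mode ω 3 (V.normalOrderedProduct l) = 0) := by
    intro l
    induction l with
    | nil => exact fun _ => ⟨0, by simpa [normalOrderedProduct] using V.vac_mem_weightSpace,
        by norm_num⟩
    | cons t l ih =>
      obtain ⟨j, w⟩ := t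
      intro ht
      obtain ⟨m, hm, hm4⟩ := hX w (ht (j, w) (by simp))
      obtain ⟨n, hn, hn4⟩ := ih fun t h => ht t (by simp [h])
      rw [normalOrderedProduct]
      generalize V.normalOrderedProduct l = u at hn hn4 ⊢
      refine ⟨m + 2 * j + n, V.mode_mem_weightSpace (V.T_iterate_mem_weightSpace hm j) hn
        (by push_cast; ring), fun h4 => ?_⟩
      -- Weights are counted in halves, so m + 2j + n = 4. Factors with m = 1 or n = 1 lie in W(1/2)
      -- = 0, and m = 0 means a multiple of the vacuum. What is left is :ab:, Ta and a single weight
      -- 2 generator.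
      have hcases : m = 0 ∨ m = 1 ∨ (m = 2 ∧ j = 0 ∧ n = 2) ∨ (m = 2 ∧ j = 1 ∧ n = 0) ∨
        (j = 0 ∧ n = 1) ∨ (m = 4 ∧ j = 0 ∧ n = 0) := by omega
      have hiter : ∀ j, V.T^[j] 0 = 0 := Function.iterate_fixed V.T_zero
      rcases hcases with rfl | rfl | ⟨rfl, rfl, rfl⟩ | ⟨rfl, rfl, rfl⟩ | ⟨rfl, rfl⟩ | ⟨rfl, rfl, rfl⟩
      · obtain ⟨r, rfl⟩ := V.exists_smul_vac (by simpa using hm)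
        rcases j with _ | j
        · obtain rfl : n = 4 := by omega
          simp [mode_smul, vac_mode_apply, hn4]
        · rw [Function.iterate_succ_apply, T_smul, T_vac, smul_zero, hiter, mode_zero]; simp
      · rw [Nat.cast_one, h_half] at hm
        rw [(Submodule.mem_bot ℂ).1 hm, hiter, mode_zero]; simp
      · norm_num at hm hn
        exact hω.three_normal hm hn
      · norm_num at hm hn
        obtain ⟨r, rfl⟩ := V.exists_smul_vac hn
        rw [map_smul, mode_vac_neg, map_smul]
        simp [hω.three_T hm]
      · rw [Nat.cast_one, h_half] at hn
        rw [(Submodule.mem_bot ℂ).1 hn]; simp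
      · norm_num at hn
        obtain ⟨r, rfl⟩ := V.exists_smul_vac hn
        rw [map_smul, mode_vac_neg, map_smul]
        simp [hm4]
  -- A sum of monomials may have many weights; independence of the weight spaces then isolates its
  -- weight 2 part.
  have hle : Submodule.span ℂ {u | ∃ l : List (ℕ × W),
      (∀ t ∈ l, t.2 ∈ ((V.weightSpace 1 : Set W) ∪ ({ω} ∪ S))) ∧ u = V.normalOrderedProduct l} ≤
      (V.weightSpace 2 ⊓ LinearMap.ker (V.mode ω 3)) ⊔
        ⨆ δ, ⨆ (_ : δ ≠ (2 : ℂ)), V.weightSpace δ := by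
    refine Submodule.span_le.2 ?_
    rintro _ ⟨l, hlX, rfl⟩
    obtain ⟨n, hn, hn4⟩ := hl l hlX
    obtain rfl | hne := eq_or_ne n 4
    · norm_num at hn
      exact Submodule.mem_sup_left ⟨hn, hn4 rfl⟩
    · refine Submodule.mem_sup_right
        (le_iSup₂ (f := fun δ (_ : δ ≠ (2 : ℂ)) => V.weightSpace δ) _ (fun h => hne ?_) hn)
      have : (n : ℂ) = 4 := by linear_combination 2 * h
      exact_mod_cast this
  obtain ⟨u, hu, r, hr, rfl⟩ := Submodule.mem_sup.1 (hle (hgen ▸ trivial : a ∈ _))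
  have hr2 : r ∈ V.weightSpace 2 := by
    have := sub_mem ha hu.1
    rwa [add_sub_cancel_left] at this
  rw [Submodule.disjoint_def.1 (V.iSupIndep_weightSpace 2) r hr2 hr, add_zero]
  exact hu.2

end IsCosetVector

end ConformalVertexAlgebra

namespace ConformalVertexAlgebra

open VertexSuperalgebra

variable {W : Type*} [AddCommGroup W] [Module ℂ W] {V : ConformalVertexAlgebra W}

/-! ### The Sugawara vector of 𝔞 and its coset vector. -/

namespace SugawaraDatum

variable (D : V.SugawaraDatum)

theorem le_weightSpace (i : Fin (D.r + 1)) : D.𝔞 i ≤ V.weightSpace 1 :=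
  D.iSup_eq ▸ le_iSup D.𝔞 i

/-- By skew-symmetry the bracket lies in both ideals, whose intersection is zero. -/
theorem mode_zero_eq_zero {i j : Fin (D.r + 1)} (hij : i ≠ j) {a b : W} (ha : a ∈ D.𝔞 i)
    (hb : b ∈ D.𝔞 j) : V.mode a 0 b = 0 := by
  have h1 : V.mode a 0 b ∈ D.𝔞 j := D.ideal j a (D.le_weightSpace i ha) b hb
  refine Submodule.disjoint_def.1 (D.indep.pairwiseDisjoint hij) _ ?_ h1
  clear h1
  refine (D.graded i).induction (P := fun a => V.mode a 0 b ∈ D.𝔞 i) ?_ ?_ ha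
  · intro a a' h h'; rw [mode_add]; exact add_mem h h'
  intro p a hai hap
  have ha1 := D.le_weightSpace i hai
  refine (D.graded j).induction (P := fun b => V.mode a 0 b ∈ D.𝔞 i) ?_ ?_ hb
  · intro b b' h h'; rw [map_add]; exact add_mem h h'
  intro q b hbj hbq
  have hb1 := D.le_weightSpace j hbj
  have := V.skew_symmetry hbq (V.koszul q a) 0 (N := 2) fun n hn => by
    simpa using V.mode_ge_two_eq_zero hb1
      (D.le_weightSpace i ((D.graded i).koszul_mem q hai)) n hn
  rw [koszul_koszul] at this
  obtain ⟨r, hr⟩ := V.exists_mode_one hb1 (D.le_weightSpace i ((D.graded i).koszul_mem q hai))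
  simp [Finset.sum_range_succ, hr, mode_smul, vac_mode_apply, mode_vac_neg] at this
  rw [this]
  exact neg_mem (D.ideal i b hb1 _ ((D.graded i).koszul_mem q hai))

/-- The derived algebra is a nonzero graded ideal of a simple superalgebra. -/
theorem perfect (i : Fin D.r) : D.𝔞 i.succ ≤
    Submodule.span ℂ {u | ∃ a ∈ D.𝔞 i.succ, ∃ b ∈ D.𝔞 i.succ, u = V.mode a 0 b} := by
  set I := Submodule.span ℂ {u | ∃ a ∈ D.𝔞 i.succ, ∃ b ∈ D.𝔞 i.succ, u = V.mode a 0 b} with hI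
  have hs := D.simple i
  have hmem : ∀ a ∈ D.𝔞 i.succ, ∀ b ∈ D.𝔞 i.succ, V.mode a 0 b ∈ I := fun a ha b hb =>
    Submodule.subset_span ⟨a, ha, b, hb, rfl⟩
  have hle : I ≤ D.𝔞 i.succ := by
    refine Submodule.span_le.2 ?_
    rintro _ ⟨a, ha, b, hb, rfl⟩
    exact hs.closed a ha b hb
  have hgr : V.IsGraded I := by
    refine Submodule.span_le.2 ?_
    rintro _ ⟨a, ha, b, hb, rfl⟩
    refine hs.graded.induction (P := fun a => V.mode a 0 b ∈
      (I ⊓ V.parity 0) ⊔ (I ⊓ V.parity 1)) ?_ ?_ ha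
    · intro a a' h h'; rw [mode_add]; exact add_mem h h'
    intro p a ha hap
    refine hs.graded.induction (P := fun b => V.mode a 0 b ∈
      (I ⊓ V.parity 0) ⊔ (I ⊓ V.parity 1)) ?_ ?_ hb
    · intro b b' h h'; rw [map_add]; exact add_mem h h'
    intro q b hb hbq
    have := V.mode_mem_parity hap hbq 0
    rcases zmod_two_eq (p + q) with h | h <;> rw [h] at this
    · exact Submodule.mem_sup_left ⟨hmem a ha b hb, this⟩
    · exact Submodule.mem_sup_right ⟨hmem a ha b hb, this⟩
  rcases hs.eq_bot_or_eq I hle hgr fun a ha b hb => hmem a ha b (hle hb) with h | h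
  · obtain ⟨a, ha, b, hb, hne⟩ := hs.nonabelian
    exact absurd (by simpa [h] using hmem a ha b hb) hne
  · exact h.ge

/-- By perfectness it suffices to take a = [u,v], and ⟨[u,v],b⟩ comes down to [u,b] = 0. When the
perfect summand is the second argument, evenness of 𝔞_0 and symmetry of the form reduce to this. -/
theorem mode_one_eq_zero_of_succ {i : Fin D.r} {j : Fin (D.r + 1)} (hij : i.succ ≠ j) {a b : W}
    (ha : a ∈ D.𝔞 i.succ) (hb : b ∈ D.𝔞 j) : V.mode a 1 b = 0 := by
  have hb1 := D.le_weightSpace j hb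
  suffices h : Submodule.span ℂ {u | ∃ a ∈ D.𝔞 i.succ, ∃ b ∈ D.𝔞 i.succ, u = V.mode a 0 b} ≤
      LinearMap.ker ((V.product 1).flip b) from h (D.perfect i ha)
  refine Submodule.span_le.2 ?_
  rintro _ ⟨u, hu, v, hv, rfl⟩
  change V.mode (V.mode u 0 v) 1 b = 0
  refine (D.graded i.succ).induction (P := fun u => V.mode (V.mode u 0 v) 1 b = 0) ?_ ?_ hu
  · intro a a' h h'
    rw [mode_add, LinearMap.add_apply, mode_add, LinearMap.add_apply, h, h', add_zero]
  intro p u hu hup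
  have h := V.supercommutator hup v b 0 1 (N := 2)
    (V.mode_ge_two_eq_zero (D.le_weightSpace _ hu) (D.le_weightSpace _ hv))
  obtain ⟨r, hr⟩ := V.exists_mode_one (D.le_weightSpace _ hv) hb1
  simp [Finset.sum_range_succ, hr, D.mode_zero_eq_zero hij hu hb, V.mode_vac_of_nonneg] at h
  exact h.symm

theorem mode_one_comm_of_even {a b : W} (ha : a ∈ V.weightSpace 1) (hb : b ∈ V.weightSpace 1)
    (hae : a ∈ V.parity 0) : V.mode b 1 a = V.mode a 1 b := by
  have := V.skew_symmetry hae b 1 (N := 1) fun j hj => by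
    exact_mod_cast V.mode_ge_two_eq_zero ha hb (1 + j) (by omega)
  simpa [koszul_zero, mode_vac_neg] using this

theorem mode_nat_eq_zero {i j : Fin (D.r + 1)} (hij : i ≠ j) {a b : W} (ha : a ∈ D.𝔞 i)
    (hb : b ∈ D.𝔞 j) (n : ℕ) : V.mode a n b = 0 := by
  have ha1 := D.le_weightSpace i ha
  have hb1 := D.le_weightSpace j hb
  rcases n with _ | _ | n
  · exact D.mode_zero_eq_zero hij ha hb
  · rw [zero_add, Nat.cast_one]
    rcases Fin.eq_zero_or_eq_succ i with rfl | ⟨i, rfl⟩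
    · rcases Fin.eq_zero_or_eq_succ j with rfl | ⟨j, rfl⟩
      · exact absurd rfl hij
      · rw [← mode_one_comm_of_even ha1 hb1 (D.zero_even ha)]
        exact D.mode_one_eq_zero_of_succ hij.symm hb ha
    · exact D.mode_one_eq_zero_of_succ hij ha hb
  · exact V.mode_ge_two_eq_zero ha1 hb1 _ (by omega)

theorem isAffine (i : Fin D.r) : V.IsAffine (D.𝔞 i.succ) (D.form i) (D.k i) where
  form := D.form_invariant i
  graded := D.graded _
  closed := (D.simple i).closed
  perfect := D.perfect i
  mode_one := D.form_eq i
  mode_ge_two _ ha _ hb := V.mode_ge_two_eq_zero (D.le_weightSpace _ ha) (D.le_weightSpace _ hb)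

/-- The unnormalized Sugawara vector of the `i`-th basic summand. -/
noncomputable def casimirVector (i : Fin D.r) : W :=
  ∑ j, V.mode (D.y i j : W) (-1) (D.x i j : W)

theorem sugawara_eq : D.sugawara =
    (1 / 2 : ℂ) • ∑ i, V.mode (D.e (Sum.inr i) : W) (-1) (D.e (Sum.inr i) : W)
      + ∑ i, (1 / (2 * ((D.k i : ℂ) + D.h i))) • D.casimirVector i := rfl

/-- A property of the Sugawara vector that holds for the products of two currents and is linear. -/
theorem sugawara_mem {U : Submodule ℂ W}
    (hU : ∀ a ∈ V.weightSpace 1, ∀ b ∈ V.weightSpace 1, V.mode a (-1) b ∈ U) :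
    D.sugawara ∈ U := by
  refine add_mem (U.smul_mem _ (U.sum_mem fun i _ => ?_))
    (U.sum_mem fun i _ => U.smul_mem _ (U.sum_mem fun j _ => ?_))
  · exact hU _ (D.le_weightSpace _ (D.e _).2) _ (D.le_weightSpace _ (D.e _).2)
  · exact hU _ (D.le_weightSpace _ (D.y i j).2) _ (D.le_weightSpace _ (D.x i j).2)

theorem sugawara_mem_weightSpace : D.sugawara ∈ V.weightSpace 2 :=
  D.sugawara_mem fun _ ha _ hb => V.mode_mem_weightSpace ha hb (by push_cast; ring)

theorem sugawara_mem_affineSubalgebra : D.sugawara ∈ V.affineSubalgebra := by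
  refine D.sugawara_mem fun a ha b hb => ?_
  simp only [affineSubalgebra, subalgebraGeneratedBy, Submodule.mem_sInf]
  rintro U ⟨hU, -, hmode⟩
  exact hmode _ a (hU ha) b (hU hb)

theorem sugawara_even : D.sugawara ∈ V.parity 0 := by
  refine add_mem (Submodule.smul_mem _ _ (Submodule.sum_mem _ fun i _ => ?_))
    (Submodule.sum_mem _ fun i _ => Submodule.smul_mem _ _ ?_)
  · exact V.mode_mem_parity (p := 0) (q := 0) (D.zero_even (D.e _).2) (D.zero_even (D.e _).2) _
  · exact IsAffine.sum_normal_even (D.isAffine i) (D.dual i)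

/-- L(1):ab: = [a,b], so the claim is the vanishing of ∑ [y_j,x_j] in each simple summand and
commutativity of 𝔞_0. -/
theorem L_two_sugawara (h_primary : ∀ a ∈ V.weightSpace 1, V.IsPrimary a) :
    V.mode V.L 2 D.sugawara = 0 := by
  have h : ∀ (i j) (a : D.𝔞 i) (b : D.𝔞 j),
      V.mode V.L 2 (V.mode (a : W) (-1) (b : W)) = V.mode (a : W) 0 (b : W) := fun i j a b =>
    have ha := D.le_weightSpace _ a.2
    V.L_mode_normal ha (h_primary _ ha) (h_primary _ (D.le_weightSpace _ b.2))
  rw [sugawara, map_add, map_smul, map_sum, map_sum]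
  simp only [map_smul, map_sum, h]
  rw [Finset.sum_eq_zero fun i _ => D.zero_abelian _ (D.e _).2 _ (D.e _).2, smul_zero, zero_add]
  refine Finset.sum_eq_zero fun i _ => ?_
  have := congrArg Subtype.val (IsAffine.sum_bracket (D.isAffine i) (D.dual i))
  simp only [Submodule.coe_sum, IsAffine.coe_bracket, Submodule.coe_zero] at this
  rw [this, smul_zero]

theorem mode_casimirVector_of_ne {i : Fin D.r} {j : Fin (D.r + 1)} (hij : j ≠ i.succ) {p : ZMod 2}
    {a : W} (ha : a ∈ D.𝔞 j) (hap : a ∈ V.parity p) (n : ℕ) :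
    V.mode a n (D.casimirVector i) = 0 := by
  rw [casimirVector, map_sum]
  exact Finset.sum_eq_zero fun l _ => V.mode_normal_eq_zero hap
    (D.mode_nat_eq_zero hij ha (D.y i l).2) (D.mode_nat_eq_zero hij ha (D.x i l).2) n

theorem mode_sugawara_succ {i : Fin D.r} {p : ZMod 2} {a : W} (ha : a ∈ D.𝔞 i.succ)
    (hap : a ∈ V.parity p) (n : ℕ) : V.mode a n D.sugawara =
      (1 / (2 * ((D.k i : ℂ) + D.h i))) • V.mode a n (D.casimirVector i) := by
  rw [sugawara_eq, map_add, map_smul, map_sum, map_sum, Finset.sum_eq_zero, smul_zero, zero_add,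
    Finset.sum_eq_single i, map_smul]
  · intro j _ hj
    rw [map_smul, D.mode_casimirVector_of_ne (fun h => hj (Fin.succ_injective _ h).symm) ha hap,
      smul_zero]
  · simp
  · intro l _
    have := D.mode_nat_eq_zero (Fin.succ_ne_zero i) ha (D.e (Sum.inr l)).2
    exact V.mode_normal_eq_zero hap this this n

theorem mode_sugawara_zero {a : W} (ha : a ∈ D.𝔞 0) (n : ℕ) : V.mode a n D.sugawara =
      (1 / 2 : ℂ) • ∑ i, V.mode a n (V.mode (D.e (Sum.inr i) : W) (-1) (D.e (Sum.inr i) : W)) := by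
  rw [sugawara_eq, map_add, map_smul, map_sum, map_sum, add_eq_left]
  refine Finset.sum_eq_zero fun j _ => ?_
  rw [map_smul, D.mode_casimirVector_of_ne (Fin.succ_ne_zero j).symm ha (D.zero_even ha), smul_zero]

theorem sugawara_mode_succ {i : Fin D.r} {p : ZMod 2} {a : W} (ha : a ∈ D.𝔞 i.succ)
    (hap : a ∈ V.parity p) : V.mode D.sugawara 0 a = V.T a ∧ V.mode D.sugawara 1 a = a ∧
      ∀ n : ℕ, 2 ≤ n → V.mode D.sugawara n a = 0 := by
  have hA := D.isAffine i
  obtain ⟨h0, h1, h2⟩ := IsAffine.mode_sum_normal hA (D.dual i) (hc := D.h i)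
    (fun z => Subtype.ext (by simpa [IsAffine.coe_bracket] using D.casimir i z))
    (z := ⟨a, ha⟩) hap
  have hk : (D.k i : ℂ) + D.h i ≠ 0 := fun h => D.noncritical i (eq_neg_of_add_eq_zero_left h)
  refine V.mode_of_double_pole hap D.sugawara_even ?_ ?_ fun n hn => ?_
  · have := D.mode_sugawara_succ ha hap 0
    rw [Nat.cast_zero] at this
    rw [this, casimirVector, h0, smul_zero]
  · have := D.mode_sugawara_succ ha hap 1
    rw [Nat.cast_one] at this
    rw [this, casimirVector, h1, smul_smul, one_div, inv_mul_cancel₀ (by simpa using hk), one_smul]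
  · rw [D.mode_sugawara_succ ha hap, casimirVector, h2 n hn, smul_zero]

theorem mode_e_normal (l i : Fin D.s ⊕ Fin D.t) {r : ℂ}
    (hr : V.mode (D.e l : W) 1 (D.e i : W) = r • V.vac) :
    V.mode (D.e l : W) 0 (V.mode (D.e i : W) (-1) (D.e i : W)) = 0 ∧
    V.mode (D.e l : W) 1 (V.mode (D.e i : W) (-1) (D.e i : W)) = (2 * r) • (D.e i : W) ∧
    ∀ n : ℕ, 2 ≤ n → V.mode (D.e l : W) n (V.mode (D.e i : W) (-1) (D.e i : W)) = 0 := by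
  have hge := V.mode_ge_two_eq_zero (D.le_weightSpace _ (D.e l).2) (D.le_weightSpace _ (D.e i).2)
  have hz := D.zero_abelian _ (D.e l).2 _ (D.e i).2
  have key := V.mode_normal (D.zero_even (D.e l).2) hge (D.e i : W)
  simp only [koszul_zero, LinearMap.id_apply, hz, mode_zero, LinearMap.zero_apply, add_zero, hr,
    mode_smul, LinearMap.smul_apply, vac_mode_apply] at key
  refine ⟨?_, ?_, fun n hn => ?_⟩
  · rw [key, hz]; simp
  · rw [key, hr]
    norm_num [mode_vac_neg]
    module
  · rw [key, hge n hn, if_neg (by omega)]; simp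

/-- Isotropic basis vectors do not occur in the Sugawara vector and are orthogonal to those that do,
so they get r = 0; the others behave as under L. -/
theorem sugawara_mode_zero (l : Fin D.s ⊕ Fin D.t) {r : W}
    (hr : r = Sum.elim (fun _ => 0) (fun i => (D.e (Sum.inr i) : W)) l) :
    V.mode D.sugawara 0 (D.e l : W) = V.T r ∧ V.mode D.sugawara 1 (D.e l : W) = r ∧
      ∀ n : ℕ, 2 ≤ n → V.mode D.sugawara n (D.e l : W) = 0 := by
  have hl : (D.e l : W) ∈ D.𝔞 0 := (D.e l).2
  have hone : ∀ i : Fin D.t, V.mode (D.e l : W) 1 (D.e (Sum.inr i) : W) =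
      (if l = Sum.inr i then (1 : ℂ) else 0) • V.vac := fun i => by
    split_ifs with h
    · rw [h, D.e_normalized, one_smul]
    · rw [D.e_orthogonal _ _ h, zero_smul]
  refine V.mode_of_double_pole (D.zero_even hl) D.sugawara_even ?_ ?_ fun n hn => ?_
  · have := D.mode_sugawara_zero hl 0
    rw [Nat.cast_zero] at this
    rw [this, Finset.sum_eq_zero fun i _ => (D.mode_e_normal l _ (hone i)).1, smul_zero]
  · have := D.mode_sugawara_zero hl 1
    rw [Nat.cast_one] at this
    rw [this, Finset.sum_congr rfl fun i _ => (D.mode_e_normal l _ (hone i)).2.1, hr]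
    rcases l with l | l
    · simp
    · simp [smul_smul]
  · rw [D.mode_sugawara_zero hl,
      Finset.sum_eq_zero fun i _ => (D.mode_e_normal l _ (hone i)).2.2 n hn, smul_zero]

theorem e_inl_radical (l : Fin D.s) {b : W} (hb : b ∈ V.weightSpace 1) :
    V.mode (D.e (Sum.inl l) : W) 1 b = 0 := by
  rw [← D.iSup_eq] at hb
  induction hb using Submodule.iSup_induction' with
  | mem i b hb =>
    by_cases hi : (0 : Fin (D.r + 1)) = i
    · subst hi
      have : b = ((∑ j, D.e.repr ⟨b, hb⟩ j • D.e j : D.𝔞 0) : W) := by rw [D.e.sum_repr]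
      rw [this, Submodule.coe_sum, map_sum]
      refine Finset.sum_eq_zero fun j _ => ?_
      rw [Submodule.coe_smul, map_smul]
      by_cases hj : Sum.inl l = j
      · rw [← hj, D.e_isotropic, smul_zero]
      · rw [D.e_orthogonal _ _ hj, smul_zero]
    · exact_mod_cast D.mode_nat_eq_zero hi (D.e (Sum.inl l)).2 hb 1
  | zero => exact map_zero _
  | add a b _ _ ha hb => rw [map_add, ha, hb, add_zero]

/-- The difference of the conformal vector and the Sugawara vector is a coset vector. -/
theorem isCosetVector (h_primary : ∀ a ∈ V.weightSpace 1, V.IsPrimary a) :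
    V.IsCosetVector (V.L - D.sugawara) where
  even := sub_mem V.L_even D.sugawara_even
  weight := sub_mem V.L_mem_weightSpace D.sugawara_mem_weightSpace
  L_two := by rw [map_sub, V.L_two_L, D.L_two_sugawara h_primary, sub_zero]
  current := by
    have hadd : ∀ a b, (∃ r ∈ V.weightSpace 1, (∀ b ∈ V.weightSpace 1, V.mode r 1 b = 0) ∧
        V.mode (V.L - D.sugawara) 0 a = V.T r ∧ V.mode (V.L - D.sugawara) 1 a = r ∧
        ∀ n : ℕ, 2 ≤ n → V.mode (V.L - D.sugawara) n a = 0) →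
        (∃ r ∈ V.weightSpace 1, (∀ b ∈ V.weightSpace 1, V.mode r 1 b = 0) ∧
        V.mode (V.L - D.sugawara) 0 b = V.T r ∧ V.mode (V.L - D.sugawara) 1 b = r ∧
        ∀ n : ℕ, 2 ≤ n → V.mode (V.L - D.sugawara) n b = 0) →
        ∃ r ∈ V.weightSpace 1, (∀ b ∈ V.weightSpace 1, V.mode r 1 b = 0) ∧
        V.mode (V.L - D.sugawara) 0 (a + b) = V.T r ∧ V.mode (V.L - D.sugawara) 1 (a + b) = r ∧
        ∀ n : ℕ, 2 ≤ n → V.mode (V.L - D.sugawara) n (a + b) = 0 := by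
      rintro a b ⟨r, hr, h, h0, h1, h2⟩ ⟨r', hr', h', h0', h1', h2'⟩
      refine ⟨r + r', add_mem hr hr', fun b hb => ?_, ?_, ?_, fun n hn => ?_⟩
      · rw [mode_add, LinearMap.add_apply, h b hb, h' b hb, add_zero]
      · rw [map_add, h0, h0', T_add]
      · rw [map_add, h1, h1']
      · rw [map_add, h2 n hn, h2' n hn, add_zero]
    have hzero : ∃ r ∈ V.weightSpace 1, (∀ b ∈ V.weightSpace 1, V.mode r 1 b = 0) ∧
        V.mode (V.L - D.sugawara) 0 0 = V.T r ∧ V.mode (V.L - D.sugawara) 1 0 = r ∧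
        ∀ n : ℕ, 2 ≤ n → V.mode (V.L - D.sugawara) n 0 = 0 :=
      ⟨0, zero_mem _, fun b _ => by rw [mode_zero]; rfl, by rw [map_zero, T_zero], map_zero _,
        fun n _ => map_zero _⟩
    have hL : ∀ a ∈ V.weightSpace 1, V.mode V.L 0 a = V.T a ∧ V.mode V.L 1 a = a ∧
        ∀ n : ℕ, 2 ≤ n → V.mode V.L n a = 0 := fun a ha => by
      refine ⟨V.L_neg_one a, by simpa using V.mem_weightSpace.1 ha, fun n hn => ?_⟩
      have := (h_primary a ha).2 (n - 1) (by omega)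
      rwa [sub_add_cancel] at this
    intro a ha
    rw [← D.iSup_eq] at ha
    induction ha using Submodule.iSup_induction' with
    | mem i a ha =>
      rcases Fin.eq_zero_or_eq_succ i with rfl | ⟨i, rfl⟩
      · have : a = ((∑ j, D.e.repr ⟨a, ha⟩ j • D.e j : D.𝔞 0) : W) := by rw [D.e.sum_repr]
        rw [this, Submodule.coe_sum]
        refine Finset.sum_induction _ _ hadd hzero fun j _ => ?_
        rw [Submodule.coe_smul]
        generalize D.e.repr ⟨a, ha⟩ j = r
        have hj := D.le_weightSpace _ (D.e j).2
        obtain ⟨l0, l1, l2⟩ := hL _ hj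
        obtain ⟨s0, s1, s2⟩ := D.sugawara_mode_zero j rfl
        -- L returns e_j and the Sugawara vector returns e_j or 0; the difference is e_j for
        -- isotropic j, which lies in the radical, and 0 otherwise.
        refine ⟨r • ((D.e j : W) - Sum.elim (fun _ => 0) (fun i => (D.e (Sum.inr i) : W)) j),
          ?_, ?_, ?_, ?_, fun n hn => ?_⟩
        · refine Submodule.smul_mem _ _ ?_
          rcases j with j | j
          · simpa using hj
          · simp
        · intro b hb
          rw [mode_smul, LinearMap.smul_apply]
          rcases j with j | j
          · simp [D.e_inl_radical j hb]
          · simp [mode_zero]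
        · rw [mode_sub, LinearMap.sub_apply, map_smul, map_smul, l0, s0, T_smul, ← smul_sub]
          simp [T, mode_sub]
        · rw [mode_sub, LinearMap.sub_apply, map_smul, map_smul, l1, s1, ← smul_sub]
        · rw [mode_sub, LinearMap.sub_apply, map_smul, map_smul, l2 n hn, s2 n hn, smul_zero,
            sub_zero]
      · refine (D.graded i.succ).induction hadd (fun p a ha hap => ?_) ha
        obtain ⟨l0, l1, l2⟩ := hL a (D.le_weightSpace _ ha)
        obtain ⟨s0, s1, s2⟩ := D.sugawara_mode_succ ha hap
        refine ⟨0, zero_mem _, fun b _ => by rw [mode_zero]; rfl, ?_, ?_, fun n hn => ?_⟩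
        · rw [mode_sub, LinearMap.sub_apply, l0, s0, sub_self, T_zero]
        · rw [mode_sub, LinearMap.sub_apply, l1, s1, sub_self]
        · rw [mode_sub, LinearMap.sub_apply, l2 n hn, s2 n hn, sub_zero]
    | zero => exact hzero
    | add a b _ _ ha hb => exact hadd _ _ ha hb

/-- Since ω_3 kills L^𝔞, L_3 L^𝔞 = L^𝔞_3 L^𝔞 = (c_𝔞/2) 1, and ω_3 ω = ω_3 L = L_3 ω = L_3 L - L_3
L^𝔞. -/
theorem mode_three_self (h_primary : ∀ a ∈ V.weightSpace 1, V.IsPrimary a) {c_a : ℂ}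
    (hc_a : V.mode D.sugawara 3 D.sugawara = (c_a / 2) • V.vac) :
    V.mode (V.L - D.sugawara) 3 (V.L - D.sugawara) = ((V.c - c_a) / 2) • V.vac := by
  have hω := D.isCosetVector h_primary
  have hS : V.mode (V.L - D.sugawara) 3 D.sugawara = 0 :=
    LinearMap.mem_ker.1 (D.sugawara_mem fun a ha b hb =>
      LinearMap.mem_ker.2 (hω.three_normal ha hb))
  -- The third product of weight 2 vectors has weight 0 and the higher ones vanish, so skew-symmetry
  -- has no derivative terms; the sign -(-1)^3 is +1.
  have hL : V.mode (V.L - D.sugawara) 3 V.L = V.mode V.L 3 (V.L - D.sugawara) := by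
    have := V.skew_symmetry V.L_even (V.L - D.sugawara) 3 (N := 1) fun j hj =>
      V.eq_zero_of_mem_weightSpace (z := -j) (by omega) rfl
        (V.mode_mem_weightSpace V.L_mem_weightSpace hω.weight (by push_cast; ring))
    norm_num [koszul_zero, mode_vac_neg] at this
    simpa using this
  rw [mode_sub, LinearMap.sub_apply, hc_a, sub_eq_zero] at hS
  rw [map_sub, hL, map_sub, V.L_three_L, mode_sub, LinearMap.sub_apply, hS, hc_a]
  module

end SugawaraDatum

end ConformalVertexAlgebra

/-! ### The main theorem. -/

theorem theorem3p1 {W : Type*} [AddCommGroup W] [Module ℂ W] (V : ConformalVertexAlgebra W)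
    (φ : W →ₛₗ[starRingEnd ℂ] W) (hφ : V.IsConjugateInvolution φ) (hφL : φ V.L = V.L)
    (h_half : V.weightSpace (1 / 2) = ⊥)
    (h_primary : ∀ a ∈ V.weightSpace 1, V.IsPrimary a)
    (D : V.SugawaraDatum)
    (c_a : ℂ) (hc_a : V.mode D.sugawara 3 D.sugawara = (c_a / 2) • V.vac)
    (S : Set W) (hS : ∀ X ∈ S, ∃ n : ℕ, X ∈ V.weightSpace ((n : ℂ) / 2))
    (hgen : V.StronglyGenerates ((V.weightSpace 1 : Set W) ∪ ({V.L - D.sugawara} ∪ S)))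
    (hS2 : ∀ X ∈ S, X ∈ V.weightSpace 2 → V.mode (V.L - D.sugawara) 3 X = 0) :
    (V.idealGeneratedBy (V.L - D.sugawara) ≠ ⊤ ↔ V.c = c_a) ∧
    ((∃ J : Submodule ℂ W,
        V.IsConformallyEmbeddedInQuotient J V.affineSubalgebra D.sugawara) ↔ V.c = c_a) := by
  have hω := D.isCosetVector h_primary
  have hωω := D.mode_three_self h_primary hc_a
  have htop : ∀ J, V.IsIdeal J → V.L - D.sugawara ∈ J → J ≠ ⊤ → V.c = c_a := by
    intro J hJ hmem hne
    by_contra hc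
    have h := hJ.left (V.L - D.sugawara) 3 _ hmem
    rw [hωω, J.smul_mem_iff (div_ne_zero (sub_ne_zero.2 hc) two_ne_zero)] at h
    exact hne (V.eq_top_of_vac_mem hJ h)
  have hproper : V.c = c_a → V.modeSpan (V.L - D.sugawara) ≠ ⊤ := fun hc =>
    hω.modeSpan_ne_top h_primary fun a ha =>
      hω.three_eq_zero h_half (by rw [hωω, hc, sub_self, zero_div, zero_smul]) hS hgen hS2 ha
  have hmem := V.self_mem_modeSpan (V.L - D.sugawara)
  refine ⟨⟨fun h => ?_, fun hc h => ?_⟩, ⟨?_, fun hc => ?_⟩⟩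
  · by_contra hc
    -- If c ≠ c_𝔞, every ideal in the intersection defining the generated ideal is W, hence so is
    -- the intersection.
    refine h (eq_top_iff.2 (le_sInf fun J hJ => ?_))
    by_contra hJt
    exact hc (htop J hJ.1 hJ.2 fun h => hJt h.ge)
  · exact hproper hc (top_le_iff.1 (h ▸ V.idealGeneratedBy_le hω.isIdeal_modeSpan hmem))
  · rintro ⟨J, hJ⟩
    exact htop J hJ.ideal ((Submodule.Quotient.eq J).1 hJ.conformal.symm) hJ.proper
  · exact ⟨_, hω.isIdeal_modeSpan, hproper hc, D.sugawara_mem_affineSubalgebra,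
      ((Submodule.Quotient.eq _).2 hmem).symm⟩
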